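/- Setting. Fix an inverse temperature $\beta>0$ and a chemical potential $\mu\in\mathbb R$. A state is a triple $R=(\rho,H,N)$ on a finite-dimensional Hilbert space, with $\rho$ a density operator, $H$ a Hamiltonian and $N$ a number operator, pairwise commuting; $r$ denotes the vector of eigenvalues of $\rho$. The free state associated with $R$ is $G_R=(\gamma_R,H,N)$, $\gamma_R=e^{-\beta(H-\mu N)}/Z$, with state vector $g_R$. States compose by $R+S=(\rho\otimes\sigma,\,H_R\otimes 1+1\otimes H_S,\,N_R\otimes 1+1\otimes N_S)$. An equilibrating operation on $R$ draws a free state $G$ (of arbitrary finite dimension), applies to $R+G$ a unitary that commutes with $H_R+H_G$ and with $N_R+N_G$, and traces out a subsystem $A$ (the remaining system has Hamiltonian $H_R+H_G-H_A$ and number operator $N_R+N_G-N_A$). Write $R\mapsto S$ if equilibrating operations on $R$ yield outputs, on the system of $S$ and with the Hamiltonian and number operator of $S$, that are arbitrarily close to $S$ in trace distance (the bath may grow with the precision). Write $R\mapsto_\epsilon S$ if $R\mapsto S'$ for some state $S'$ that has the same Hamiltonian and number operator as $S$ and satisfies $\tfrac12\|\rho_{S'}-\rho_S\|_1\le\epsilon$.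 A battery is a system with finitely many nondegenerate energy levels and a number operator that is a multiple of the identity; $B_E$ denotes its state $(|E\rangle\langle E|,H,N)$ for a level $E$. Fix a spacing $h>0$ and a threshold $c\in\mathbb R$. A battery is admissible for $(E,W)$ if $E$ and $E+W$ are among its levels, $\beta E\ge c$, and every point between $E$ and $E+W$ is within $h$ of a level. For $0\le\epsilon<1$ define $$W_{\rm gain}^{\epsilon}(R)=\max\{W: R+B_E\mapsto_\epsilon B_{E+W}\},\qquad W_{\rm cost}^{\epsilon}(R)=\min\{W: B_{E+W}\mapsto_\epsilon R+B_E\},$$ where $W$ ranges over the reals for which the transformation is possible with some battery admissible for $(E,W)$ and some $E$. Let $$D_{\rm H}^{\epsilon}(\rho\|\sigma)=-\ln\min\{\mathrm{Tr}[Q\sigma]:0\le Q\le 1,\ \mathrm{Tr}[Q\rho]\ge 1-\epsilon\}$$ and write $D_{\rm H}^{\epsilon}(r\|g_R)$ for $D_{\rm H}^{\epsilon}(\rho\|\gamma_R)$. Theorem. Let $\beta>0$, $\mu\in\mathbb R$, $h>0$, $c\in\mathbb R$, let $R=(\rho,H,N)$ be a state, and let $0\le\epsilon<1$. The maximum and the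 minimum that define $W_{\rm gain}^\epsilon(R)$ and $W_{\rm cost}^\epsilon(R)$ exist, and $$W_{\rm gain}^{\epsilon}(R)=\tfrac1\beta D_{\rm H}^{\epsilon}(r\|g_R),$$ $$\max_{\delta\in(0,1-\epsilon]}\Big[\tfrac1\beta D_{\rm H}^{1-\epsilon-\delta}(r\|g_R)-\tfrac1\beta\ln\tfrac1\delta\Big]\le W_{\rm cost}^{\epsilon}(R),$$ where the maximum over $\delta$ is attained; and if $\epsilon>0$, then $$W_{\rm cost}^{\epsilon}(R)\le\tfrac1\beta D_{\rm H}^{1-\epsilon}(r\|g_R)-\tfrac1\beta\ln\tfrac{1-\epsilon}{\epsilon}.$$ Moreover, these quantities do not depend on the battery: for every battery and all its levels $E$ and $E+W$, the transformation $R+B_E\mapsto_\epsilon B_{E+W}$ is possible if and only if $W$ belongs to the set whose maximum is $W_{\rm gain}^\epsilon(R)$, and $B_{E+W}\mapsto_\epsilon R+B_E$ is possible if and only if $W$ belongs to the set whose minimum is $W_{\rm cost}^\epsilon(R)$. -/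

import Mathlib

open scoped Matrix Kronecker ComplexOrder

noncomputable section

namespace GrandPotential

section Systems

variable {ι κ α : Type} [Fintype ι] [DecidableEq ι] [Fintype κ] [DecidableEq κ]
  [Fintype α] [DecidableEq α]

/-- A finite-dimensional quantum system (with Hilbert space `ℂ^ι`) together with its Hamiltonian
`H` and its number operator `N`, which commute. -/
structure GPSystem (ι : Type) [Fintype ι] [DecidableEq ι] where
  H : Matrix ι ι ℂ
  N : Matrix ι ι ℂ
  isHermitian_H : H.IsHermitian
  isHermitian_N : N.IsHermitian
  commute_HN : Commute H N

/-- A state `R = (ρ, H, N)` of a grand-potential theory: a density operator, a Hamiltonian and a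
number operator that commute pairwise. -/
structure GPState (ι : Type) [Fintype ι] [DecidableEq ι] extends GPSystem ι where
  ρ : Matrix ι ι ℂ
  posSemidef_ρ : ρ.PosSemidef
  trace_ρ : ρ.trace = 1
  commute_ρH : Commute ρ H
  commute_ρN : Commute ρ N

/-- The sum `A ⊗ 1 + 1 ⊗ B` of an observable of a first system and an observable of a second
system. -/
def kronSum (A : Matrix ι ι ℂ) (B : Matrix κ κ ℂ) : Matrix (ι × κ) (ι × κ) ℂ :=
  A ⊗ₖ (1 : Matrix κ κ ℂ) + (1 : Matrix ι ι ℂ) ⊗ₖ B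

theorem isHermitian_kronSum {A : Matrix ι ι ℂ} {B : Matrix κ κ ℂ}
    (hA : A.IsHermitian) (hB : B.IsHermitian) : (kronSum A B).IsHermitian := by
  unfold kronSum Matrix.IsHermitian
  rw [Matrix.conjTranspose_add, Matrix.conjTranspose_kronecker, Matrix.conjTranspose_kronecker,
    hA.eq, hB.eq, Matrix.conjTranspose_one, Matrix.conjTranspose_one]

theorem commute_kronecker {A A' : Matrix ι ι ℂ} {B B' : Matrix κ κ ℂ}
    (hA : Commute A A') (hB : Commute B B') : Commute (A ⊗ₖ B) (A' ⊗ₖ B') := by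
  unfold Commute SemiconjBy
  rw [← Matrix.mul_kronecker_mul, ← Matrix.mul_kronecker_mul, hA.eq, hB.eq]

theorem commute_kronSum {A A' : Matrix ι ι ℂ} {B B' : Matrix κ κ ℂ}
    (hA : Commute A A') (hB : Commute B B') : Commute (kronSum A B) (kronSum A' B') := by
  unfold kronSum
  exact ((commute_kronecker hA (Commute.one_left _)).add_right
      (commute_kronecker (Commute.one_right _) (Commute.one_left _))).add_left
    ((commute_kronecker (Commute.one_left _) (Commute.one_right _)).add_right
      (commute_kronecker (Commute.one_left _) hB))

theorem commute_kronecker_kronSum {ρ A : Matrix ι ι ℂ} {σ B : Matrix κ κ ℂ}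
    (hA : Commute ρ A) (hB : Commute σ B) : Commute (ρ ⊗ₖ σ) (kronSum A B) := by
  unfold kronSum
  exact (commute_kronecker hA (Commute.one_right _)).add_right
    (commute_kronecker (Commute.one_right _) hB)

/-- The composite of two systems: Hamiltonians and number operators add. -/
def GPSystem.add (A : GPSystem ι) (B : GPSystem κ) : GPSystem (ι × κ) where
  H := kronSum A.H B.H
  N := kronSum A.N B.N
  isHermitian_H := isHermitian_kronSum A.isHermitian_H B.isHermitian_H
  isHermitian_N := isHermitian_kronSum A.isHermitian_N B.isHermitian_N
  commute_HN := commute_kronSum A.commute_HN B.commute_HN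

/-- The composition `R + S = (ρ ⊗ σ, H_R + H_S, N_R + N_S)` of two states. -/
def GPState.add (R : GPState ι) (S : GPState κ) : GPState (ι × κ) where
  toGPSystem := R.toGPSystem.add S.toGPSystem
  ρ := R.ρ ⊗ₖ S.ρ
  posSemidef_ρ := R.posSemidef_ρ.kronecker S.posSemidef_ρ
  trace_ρ := by rw [Matrix.trace_kronecker, R.trace_ρ, S.trace_ρ, one_mul]
  commute_ρH := commute_kronecker_kronSum R.commute_ρH S.commute_ρH
  commute_ρN := commute_kronecker_kronSum R.commute_ρN S.commute_ρN

/-- The unnormalised equilibrium operator `exp (-β (H - μ N))`. -/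
def boltzmann (β μ : ℝ) (A : GPSystem ι) : Matrix ι ι ℂ :=
  NormedSpace.exp ((-β) • (A.H - μ • A.N))

theorem posDef_boltzmann (β μ : ℝ) (A : GPSystem ι) : (boltzmann β μ A).PosDef := by
  have hK : (((-β / 2) • (A.H - μ • A.N)) : Matrix ι ι ℂ).IsHermitian :=
    (A.isHermitian_H.sub (A.isHermitian_N.smul (IsSelfAdjoint.all μ))).smul
      (IsSelfAdjoint.all (-β / 2))
  have hE := hK.exp
  have hsplit : boltzmann β μ A =
      (NormedSpace.exp ((-β / 2) • (A.H - μ • A.N)))ᴴ *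
        NormedSpace.exp ((-β / 2) • (A.H - μ • A.N)) := by
    rw [hE.eq, ← Matrix.exp_add_of_commute _ _ (Commute.refl _), ← add_smul, add_halves]
    rfl
  have hunit : IsUnit (boltzmann β μ A) := Matrix.isUnit_exp _
  have hpsd : (boltzmann β μ A).PosSemidef := by
    rw [hsplit]
    exact Matrix.posSemidef_conjTranspose_mul_self _
  exact hpsd.posDef_iff_isUnit.mpr hunit

/-- The free (equilibrium) state `(exp (-β (H - μ N)) / Z, H, N)` of a system. -/
def freeState [Nonempty ι] (β μ : ℝ) (A : GPSystem ι) : GPState ι where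
  toGPSystem := A
  ρ := (boltzmann β μ A).trace⁻¹ • boltzmann β μ A
  posSemidef_ρ := by
    have h := posDef_boltzmann β μ A
    exact h.posSemidef.smul (inv_nonneg.mpr h.trace_pos.le)
  trace_ρ := by
    have h := (posDef_boltzmann β μ A).trace_pos
    rw [Matrix.trace_smul, smul_eq_mul, inv_mul_cancel₀ h.ne']
  commute_ρH := by
    refine Commute.smul_left ?_ _
    refine ((((Commute.refl A.H).sub_left (A.commute_HN.symm.smul_left μ)).smul_left (-β)
      ).exp_left)
  commute_ρN := by
    refine Commute.smul_left ?_ _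
    refine (((A.commute_HN.sub_left ((Commute.refl A.N).smul_left μ)).smul_left (-β)
      ).exp_left)

/-- The partial trace over the second tensor factor. -/
def partialTrace (X : Matrix (κ × α) (κ × α) ℂ) : Matrix κ κ ℂ :=
  Matrix.of fun i j => ∑ a, X (i, a) (j, a)

/-- The trace norm `‖X‖₁ = Tr √(Xᴴ X)`, the sum of the singular values of `X`. -/
def traceNorm (X : Matrix ι ι ℂ) : ℝ :=
  ∑ i, √((Matrix.isHermitian_conjTranspose_mul_self X).eigenvalues i)

/-- The trace distance `½ ‖ρ - σ‖₁`. -/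
def traceDist (ρ σ : Matrix ι ι ℂ) : ℝ := (1 / 2) * traceNorm (ρ - σ)

/-- `σ`, on the system `S`, is the density operator that an equilibrating operation on `R` yields:
a free state `G` is drawn from the bath, a unitary `U` that conserves the total Hamiltonian and
the total number operator is applied to `R + G`, and a subsystem `A` is traced out.  The unitary
`V` identifies the Hilbert space of `R + G` with `S ⊗ A`, in such a way that the total
Hamiltonian and the total number operator become `H_S + H_A` and `N_S + N_A`. -/
def IsEquilibratingOutput (β μ : ℝ) (R : GPState ι) (S : GPSystem κ) (σ : Matrix κ κ ℂ) : Prop :=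
  ∃ (n m : ℕ) (G : GPSystem (Fin (n + 1))) (A : GPSystem (Fin m))
    (U : Matrix (ι × Fin (n + 1)) (ι × Fin (n + 1)) ℂ)
    (V : Matrix (κ × Fin m) (ι × Fin (n + 1)) ℂ),
    (U * Uᴴ = 1 ∧ Uᴴ * U = 1 ∧
      Commute U (R.add (freeState β μ G)).H ∧ Commute U (R.add (freeState β μ G)).N) ∧
    (V * Vᴴ = 1 ∧ Vᴴ * V = 1 ∧
      V * (R.add (freeState β μ G)).H * Vᴴ = (S.add A).H ∧
      V * (R.add (freeState β μ G)).N * Vᴴ = (S.add A).N) ∧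
    σ = partialTrace (V * (U * (R.add (freeState β μ G)).ρ * Uᴴ) * Vᴴ)

/-- `R ↦ S`: equilibrating operations on `R` (with ever larger baths) yield the state `S` to
within an arbitrarily small trace distance. -/
def Reaches (β μ : ℝ) (R : GPState ι) (S : GPState κ) : Prop :=
  ∀ η : ℝ, 0 < η → ∃ σ : Matrix κ κ ℂ,
    IsEquilibratingOutput β μ R S.toGPSystem σ ∧ traceDist σ S.ρ ≤ η

/-- `S' ≈_ε S`: the states have the same Hamiltonian and number operator, and their density
operators are `ε`-close in trace distance. -/
def EpsClose (ε : ℝ) (S' S : GPState κ) : Prop :=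
  S'.toGPSystem = S.toGPSystem ∧ traceDist S'.ρ S.ρ ≤ ε

/-- `R ↦_ε S`: the transformation of `R` into some state that is `ε`-close to `S`. -/
def ReachesApprox (β μ ε : ℝ) (R : GPState ι) (S : GPState κ) : Prop :=
  ∃ S' : GPState κ, EpsClose ε S' S ∧ Reaches β μ R S'

/-- The optimal type II error probability: the minimum of `Tr[Q σ]` over `0 ≤ Q ≤ 1` with
`Tr[Q ρ] ≥ 1 - ε`. -/
def typeIIError (ε : ℝ) (ρ σ : Matrix ι ι ℂ) : ℝ :=
  sInf {b : ℝ | ∃ Q : Matrix ι ι ℂ, Q.PosSemidef ∧ (1 - Q).PosSemidef ∧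
    1 - ε ≤ (Q * ρ).trace.re ∧ b = (Q * σ).trace.re}

/-- The hypothesis-testing relative entropy (in nats). -/
def hypTestRelEntropy (ε : ℝ) (ρ σ : Matrix ι ι ℂ) : ℝ :=
  -Real.log (typeIIError ε ρ σ)

end Systems

section Batteries

/-- A battery: a system with finitely many energy levels.  Its number operator is a multiple of
the identity, so that it stores energy only. -/
structure Battery where
  levels : Finset ℝ
  number : ℝ

/-- The Hamiltonian and the number operator of a battery, in its energy eigenbasis. -/
def Battery.sys (B : Battery) : GPSystem B.levels where
  H := Matrix.diagonal fun e => ((e : ℝ) : ℂ)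
  N := Matrix.diagonal fun _ => (B.number : ℂ)
  isHermitian_H := by
    rw [Matrix.IsHermitian, Matrix.diagonal_conjTranspose]
    congr 1
    ext e
    simp
  isHermitian_N := by
    rw [Matrix.IsHermitian, Matrix.diagonal_conjTranspose]
    congr 1
    ext e
    simp
  commute_HN := Matrix.commute_diagonal _ _

/-- The battery state `B_E = (|E⟩⟨E|, H, N)`, for a level `E` of the battery. -/
def Battery.state (B : Battery) (E : B.levels) : GPState B.levels where
  toGPSystem := B.sys
  ρ := Matrix.diagonal (Pi.single E 1)
  posSemidef_ρ := by
    refine Matrix.PosSemidef.diagonal fun e => ?_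
    by_cases h : e = E
    · subst h; simp
    · simp [h]
  trace_ρ := by simp [Matrix.trace_diagonal]
  commute_ρH := Matrix.commute_diagonal _ _
  commute_ρN := Matrix.commute_diagonal _ _

/-- The levels of the battery are spaced at most `2 h` apart in the range between the energies
`E` and `E'`: every point of that range is within `h` of a level. -/
def Battery.FinelySpaced (B : Battery) (h E E' : ℝ) : Prop :=
  ∀ x ∈ Set.uIcc E E', ∃ e ∈ B.levels, |x - e| ≤ h

variable {ι : Type} [Fintype ι] [DecidableEq ι]

/-- The values `W` such that `R + B_E ↦_ε B_{E + W}` for a battery with levels `E` and `E + W`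
that is `h`-finely spaced between them and satisfies `β E ≥ c`. -/
def workGainSet (β μ h c ε : ℝ) (R : GPState ι) : Set ℝ :=
  {W | ∃ (B : Battery) (E F : B.levels), (F : ℝ) = E + W ∧ c ≤ β * E ∧ B.FinelySpaced h E F ∧
    ReachesApprox β μ ε (R.add (B.state E)) (B.state F)}

/-- The values `W` such that `B_{E + W} ↦_ε R + B_E` for a battery with levels `E` and `E + W`
that is `h`-finely spaced between them and satisfies `β E ≥ c`. -/
def workCostSet (β μ h c ε : ℝ) (R : GPState ι) : Set ℝ :=
  {W | ∃ (B : Battery) (E F : B.levels), (F : ℝ) = E + W ∧ c ≤ β * E ∧ B.FinelySpaced h E F ∧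
    ReachesApprox β μ ε (B.state F) (R.add (B.state E))}

end Batteries

end GrandPotential

end

/-! Since `ρ`, `H` and `N` commute, they share an eigenbasis, and a state reduces to a probability
vector `r` over levels together with an equilibrium vector `g`. Transformations are then governed by
couplings of the equilibrium vectors of input and output.

Necessity is `IsEquilibratingOutput.pullback`: conserving unitaries preserve the Boltzmann operator,
so a test on the output pulls back, in the Heisenberg picture, to a test on the input with the same
equilibrium expectation. `ReachesApprox.pullback` lets the output be off by `ε` and removes the
arbitrarily small error by compactness.

Sufficiency is `reachesApprox_of_subcoupling`: a subcoupling of the equilibrium vectors that carries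
`r` to at least `1 - ε` of the target is enough. It rests on `exists_reservoir_perm`. The reservoir
levels are occupation numbers, with degeneracies nearly inverse to their Boltzmann factors. In a
sector of fixed total occupation numbers away from the boundary, the system levels then occur in
proportion to their Boltzmann factors. A coupling becomes a table of integer counts that a
permutation within the sector realizes, up to rounding and boundary effects that vanish for a large
reservoir. A sector fixes energy and particle number together, whatever the spectra.

A battery enters only through the ratio `exp (-β (F - E))` of two equilibrium weights. By
`reachesApprox_gain_iff`, work `W` can be gained iff the optimal type II error is at most `exp (-β
W)`. By `reachesApprox_cost_iff`, work `W` suffices iff `r(A) - ε ≤ exp (β W) g(A)` for every event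
`A`. Hence the cost is `(1/β) ln M`, with `M` the maximum of `(r(A) - ε) / g(A)`. Neyman–Pearson
duality gives `δ ≤ M t`, with `t` the type II error at level `1 - ε - δ`, and equality at `δ = r(A)
- ε` for a maximizing `A`; so the lower bound is even an equality. The indicator of that `A`,
rescaled to have `r`-probability `ε`, gives the upper bound. -/

noncomputable section

namespace GrandPotential

/-! ### Simultaneous diagonalization, trace norm and partial trace. -/

section LinearAlgebra

variable {ι κ α τ : Type} [Fintype ι] [DecidableEq ι] [Fintype κ] [DecidableEq κ]
  [Fintype α] [DecidableEq α]

/-- A diagonal matrix with real entries, as a complex matrix. -/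
def realDiag (d : ι → ℝ) : Matrix ι ι ℂ := Matrix.diagonal fun i => (d i : ℂ)

/-- The operator with eigenvalues `d` in the basis formed by the columns of `W`. -/
def inFrame (W : Matrix ι ι ℂ) (d : ι → ℝ) : Matrix ι ι ℂ := W * realDiag d * Wᴴ

/-- A two-sided unitary, possibly between spaces with different index types. -/
def IsUnitaryMat (V : Matrix κ ι ℂ) : Prop := V * Vᴴ = 1 ∧ Vᴴ * V = 1

omit [DecidableEq ι] in
/-- An orthonormal basis of joint eigenvectors yields a unitary that diagonalizes. -/
theorem exists_eigenbasis_of_commute (M : τ → Matrix ι ι ℂ) (hM : ∀ t, (M t).IsHermitian)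
    (hC : ∀ s t, Commute (M s) (M t)) :
    ∃ (b : OrthonormalBasis ι ℂ (EuclideanSpace ℂ ι)) (d : τ → ι → ℂ),
      ∀ t i, (M t) *ᵥ (b i).ofLp = d t i • (b i).ofLp := by
  classical
  let T : τ → Module.End ℂ (EuclideanSpace ℂ ι) := fun t => Matrix.toEuclideanLin (M t)
  have hT : ∀ t, (T t).IsSymmetric := fun t => Matrix.isSymmetric_toEuclideanLin_iff.mpr (hM t)
  have hTC : Pairwise (Function.onFun Commute T) := by
    intro s t _
    have h := (hC s t).eq
    change T s * T t = T t * T s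
    apply LinearMap.ext
    intro v
    apply (WithLp.equiv 2 (ι → ℂ)).injective
    simp [T, Matrix.toLpLin_apply, h]
  have hint := LinearMap.IsSymmetric.directSum_isInternal_of_pairwise_commute hT hTC
  have horth := LinearMap.IsSymmetric.orthogonalFamily_iInf_eigenspaces hT
  set V : (τ → ℂ) → Submodule ℂ (EuclideanSpace ℂ ι) :=
    fun χ => ⨅ j, Module.End.eigenspace (T j) (χ j) with hV
  -- The label `χ` ranges over all functions `τ → ℂ`; a finite index type is obtained by keeping
  -- only the nonzero joint eigenspaces, finitely many because they are independent.
  have hfin : {χ | V χ ≠ ⊥}.Finite :=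
    WellFoundedGT.finite_ne_bot_of_iSupIndep hint.submodule_iSupIndep
  have : Fintype {χ // V χ ≠ ⊥} := hfin.fintype
  have hint' : DirectSum.IsInternal (fun χ : {χ // V χ ≠ ⊥} => V χ) :=
    DirectSum.isInternal_ne_bot_iff.mpr hint
  have horth' : OrthogonalFamily ℂ (fun χ : {χ // V χ ≠ ⊥} => V χ)
      fun χ => (V χ).subtypeₗᵢ := horth.comp Subtype.coe_injective
  have hrank : Module.finrank ℂ (EuclideanSpace ℂ ι) = Fintype.card ι := by simp
  let b := hint'.subordinateOrthonormalBasis hrank horth'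
  let e : Fin (Fintype.card ι) ≃ ι := (Fintype.equivFin ι).symm
  refine ⟨b.reindex e,
    fun t i => (hint'.subordinateOrthonormalBasisIndex hrank (e.symm i) horth').1 t, ?_⟩
  intro t i
  have hmem := hint'.subordinateOrthonormalBasis_subordinate hrank (e.symm i) horth'
  have h1 := (Submodule.mem_iInf _).mp hmem t
  have h2 := congrArg WithLp.ofLp (Module.End.mem_eigenspace_iff.mp h1)
  simpa [T, b, Matrix.toLpLin_apply] using h2

/-- Pairwise commuting Hermitian matrices are simultaneously unitarily diagonalizable. -/
theorem exists_inFrame_of_commute (M : τ → Matrix ι ι ℂ) (hM : ∀ t, (M t).IsHermitian)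
    (hC : ∀ s t, Commute (M s) (M t)) :
    ∃ W : Matrix ι ι ℂ, IsUnitaryMat W ∧ ∃ d : τ → ι → ℝ, ∀ t, M t = inFrame W (d t) := by
  obtain ⟨b, d, hd⟩ := exists_eigenbasis_of_commute M hM hC
  let W : Matrix ι ι ℂ := Matrix.of fun i j => (b j).ofLp i
  have hW : Wᴴ * W = 1 := by
    ext i j
    have h := orthonormal_iff_ite.mp b.orthonormal i j
    rw [Matrix.mul_apply, Matrix.one_apply, ← h, PiLp.inner_apply]
    simp [W, Matrix.conjTranspose_apply, mul_comm]
  have hW' : W * Wᴴ = 1 := mul_eq_one_comm.mp hW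
  have hMW : ∀ t, M t * W = W * Matrix.diagonal (d t) := by
    intro t
    ext i j
    have h := congrFun (hd t j) i
    rw [Matrix.mul_diagonal]
    simpa [W, Matrix.mul_apply, Matrix.mulVec, dotProduct, mul_comm] using h
  have hreal : ∀ t j, ((d t j).re : ℂ) = d t j := by
    intro t j
    have h1 : Wᴴ * M t * W = Matrix.diagonal (d t) := by
      rw [Matrix.mul_assoc, hMW, ← Matrix.mul_assoc, hW, Matrix.one_mul]
    have h2 : (Wᴴ * M t * W).IsHermitian := Matrix.isHermitian_conjTranspose_mul_mul W (hM t)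
    rw [h1] at h2
    have h3 := h2.apply j j
    simp only [Matrix.diagonal_apply_eq] at h3
    exact Complex.conj_eq_iff_re.mp h3
  refine ⟨W, ⟨hW', hW⟩, fun t i => (d t i).re, fun t => ?_⟩
  have : realDiag (fun i => (d t i).re) = Matrix.diagonal (d t) := by
    unfold realDiag
    congr 1
    ext i
    exact hreal t i
  rw [inFrame, this, ← hMW, Matrix.mul_assoc, hW', Matrix.mul_one]

theorem IsUnitaryMat.conjTranspose {V : Matrix κ ι ℂ} (h : IsUnitaryMat V) :
    IsUnitaryMat Vᴴ := by
  unfold IsUnitaryMat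
  rw [Matrix.conjTranspose_conjTranspose]
  exact ⟨h.2, h.1⟩

theorem IsUnitaryMat.mul {V : Matrix κ ι ℂ} {W : Matrix ι α ℂ} (hV : IsUnitaryMat V)
    (hW : IsUnitaryMat W) : IsUnitaryMat (V * W) := by
  constructor
  · rw [Matrix.conjTranspose_mul, Matrix.mul_assoc, ← Matrix.mul_assoc W, hW.1, Matrix.one_mul, hV.1]
  · rw [Matrix.conjTranspose_mul, Matrix.mul_assoc, ← Matrix.mul_assoc Vᴴ, hV.2, Matrix.one_mul, hW.2]

theorem isUnitaryMat_one : IsUnitaryMat (1 : Matrix ι ι ℂ) := by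
  simp [IsUnitaryMat]

theorem IsUnitaryMat.kronecker {V : Matrix ι ι ℂ} {W : Matrix κ κ ℂ} (hV : IsUnitaryMat V)
    (hW : IsUnitaryMat W) : IsUnitaryMat (V ⊗ₖ W) := by
  constructor
  · rw [Matrix.conjTranspose_kronecker, ← Matrix.mul_kronecker_mul, hV.1, hW.1,
      Matrix.one_kronecker_one]
  · rw [Matrix.conjTranspose_kronecker, ← Matrix.mul_kronecker_mul, hV.2, hW.2,
      Matrix.one_kronecker_one]

omit [Fintype ι] in
theorem realDiag_one : realDiag (fun _ : ι => (1 : ℝ)) = 1 := by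
  simp [realDiag]

theorem inFrame_one {W : Matrix ι ι ℂ} (hW : IsUnitaryMat W) :
    inFrame W (fun _ => 1) = 1 := by
  rw [inFrame, realDiag_one, Matrix.mul_one, hW.1]

theorem inFrame_sub (W : Matrix ι ι ℂ) (d d' : ι → ℝ) :
    inFrame W d - inFrame W d' = inFrame W (fun i => d i - d' i) := by
  have : realDiag (fun i => d i - d' i) = realDiag d - realDiag d' := by
    simp [realDiag, Matrix.diagonal_sub]
  rw [inFrame, inFrame, inFrame, this, Matrix.mul_sub, Matrix.sub_mul]

theorem inFrame_add (W : Matrix ι ι ℂ) (d d' : ι → ℝ) :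
    inFrame W d + inFrame W d' = inFrame W (fun i => d i + d' i) := by
  have : realDiag (fun i => d i + d' i) = realDiag d + realDiag d' := by
    simp [realDiag, Matrix.diagonal_add]
  rw [inFrame, inFrame, inFrame, this, Matrix.mul_add, Matrix.add_mul]

theorem inFrame_smul (W : Matrix ι ι ℂ) (c : ℝ) (d : ι → ℝ) :
    c • inFrame W d = inFrame W (fun i => c * d i) := by
  have : realDiag (fun i => c * d i) = c • realDiag d := by
    ext i j
    by_cases h : i = j <;> simp [realDiag, h]
  rw [inFrame, inFrame, this, Matrix.mul_smul, Matrix.smul_mul]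

theorem inFrame_mul {W : Matrix ι ι ℂ} (hW : IsUnitaryMat W) (d d' : ι → ℝ) :
    inFrame W d * inFrame W d' = inFrame W (fun i => d i * d' i) := by
  have : realDiag (fun i => d i * d' i) = realDiag d * realDiag d' := by
    simp [realDiag]
  rw [inFrame, inFrame, inFrame, this]
  simp only [Matrix.mul_assoc]
  rw [← Matrix.mul_assoc Wᴴ W, hW.2, Matrix.one_mul]

theorem inFrame_kronecker (W : Matrix ι ι ℂ) (W' : Matrix κ κ ℂ) (d : ι → ℝ) (d' : κ → ℝ) :
    inFrame W d ⊗ₖ inFrame W' d' = inFrame (W ⊗ₖ W') (fun p => d p.1 * d' p.2) := by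
  have : realDiag (fun p : ι × κ => d p.1 * d' p.2) = realDiag d ⊗ₖ realDiag d' := by
    simp [realDiag, Matrix.diagonal_kronecker_diagonal]
  rw [inFrame, inFrame, inFrame, this, Matrix.conjTranspose_kronecker, ← Matrix.mul_kronecker_mul,
    ← Matrix.mul_kronecker_mul]

theorem kronSum_inFrame {W : Matrix ι ι ℂ} {W' : Matrix κ κ ℂ} (hW : IsUnitaryMat W)
    (hW' : IsUnitaryMat W') (d : ι → ℝ) (d' : κ → ℝ) :
    kronSum (inFrame W d) (inFrame W' d') = inFrame (W ⊗ₖ W') (fun p => d p.1 + d' p.2) := by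
  rw [kronSum, ← inFrame_one hW', ← inFrame_one hW, inFrame_kronecker, inFrame_kronecker,
    inFrame_add]
  simp

theorem isHermitian_inFrame (W : Matrix ι ι ℂ) (d : ι → ℝ) : (inFrame W d).IsHermitian := by
  refine Matrix.isHermitian_mul_mul_conjTranspose W ?_
  simp [Matrix.IsHermitian, realDiag, Matrix.diagonal_conjTranspose, Pi.star_def]

theorem posSemidef_inFrame (W : Matrix ι ι ℂ) {d : ι → ℝ} (hd : ∀ i, 0 ≤ d i) :
    (inFrame W d).PosSemidef := by
  refine Matrix.PosSemidef.mul_mul_conjTranspose_same ?_ W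
  exact Matrix.PosSemidef.diagonal fun i => by simpa using hd i

theorem one_sub_inFrame_posSemidef {W : Matrix ι ι ℂ} (hW : IsUnitaryMat W) {d : ι → ℝ}
    (hd : ∀ i, d i ≤ 1) : (1 - inFrame W d).PosSemidef := by
  rw [← inFrame_one hW, inFrame_sub]
  exact posSemidef_inFrame W fun i => by simpa using hd i

/-- The trace of `X * inFrame W d` is the pairing of `d` with the diagonal of `X` in the frame. -/
theorem trace_mul_inFrame (X W : Matrix ι ι ℂ) (d : ι → ℝ) :
    (X * inFrame W d).trace.re = ∑ i, ((Wᴴ * X * W) i i).re * d i := by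
  rw [inFrame, ← Matrix.mul_assoc, Matrix.trace_mul_comm, ← Matrix.mul_assoc, ← Matrix.mul_assoc,
    Matrix.trace, Complex.re_sum]
  refine Finset.sum_congr rfl fun i _ => ?_
  rw [Matrix.diag_apply, realDiag, Matrix.mul_diagonal, Complex.re_mul_ofReal]

theorem frame_conj_inFrame {W : Matrix ι ι ℂ} (hW : IsUnitaryMat W) (d : ι → ℝ) :
    Wᴴ * inFrame W d * W = realDiag d := by
  rw [inFrame, Matrix.mul_assoc, Matrix.mul_assoc, hW.2, Matrix.mul_one, ← Matrix.mul_assoc, hW.2,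
    Matrix.one_mul]

theorem trace_inFrame_mul_inFrame {W : Matrix ι ι ℂ} (hW : IsUnitaryMat W) (q d : ι → ℝ) :
    (inFrame W q * inFrame W d).trace.re = ∑ i, q i * d i := by
  rw [trace_mul_inFrame, frame_conj_inFrame hW]
  simp [realDiag]

theorem trace_inFrame {W : Matrix ι ι ℂ} (hW : IsUnitaryMat W) (d : ι → ℝ) :
    (inFrame W d).trace = ((∑ i, d i : ℝ) : ℂ) := by
  rw [inFrame, Matrix.trace_mul_comm, ← Matrix.mul_assoc, hW.2, Matrix.one_mul, realDiag,
    Matrix.trace_diagonal]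
  simp

theorem posSemidef_inFrame_iff {W : Matrix ι ι ℂ} (hW : IsUnitaryMat W) {d : ι → ℝ} :
    (inFrame W d).PosSemidef ↔ ∀ i, 0 ≤ d i := by
  refine ⟨fun h i => ?_, posSemidef_inFrame W⟩
  have h1 := h.conjTranspose_mul_mul_same W
  rw [frame_conj_inFrame hW] at h1
  have h2 := h1.diag_nonneg (i := i)
  simpa [realDiag] using h2

/-- The diagonal of an effect in an orthonormal basis lies in `[0, 1]`. -/
theorem effect_diag_mem {W Q : Matrix ι ι ℂ} (hW : IsUnitaryMat W) (h0 : Q.PosSemidef)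
    (h1 : (1 - Q).PosSemidef) (i : ι) : ((Wᴴ * Q * W) i i).re ∈ Set.Icc (0 : ℝ) 1 := by
  have h2 := (h0.conjTranspose_mul_mul_same W).diag_nonneg (i := i)
  have h3 := (h1.conjTranspose_mul_mul_same W).diag_nonneg (i := i)
  rw [Matrix.mul_sub, Matrix.sub_mul, Matrix.mul_one, hW.2, Matrix.sub_apply,
    Matrix.one_apply_eq] at h3
  have h2' := (Complex.le_def.mp h2).1
  have h3' := (Complex.le_def.mp h3).1
  simp only [Complex.zero_re, Complex.sub_re, Complex.one_re] at h2' h3'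
  exact ⟨h2', by linarith⟩

theorem roots_charpoly_realDiag (d : ι → ℝ) :
    (realDiag d).charpoly.roots = Multiset.map (fun i => (d i : ℂ)) Finset.univ.val := by
  rw [realDiag, Matrix.charpoly_diagonal, Polynomial.roots_prod _ _ (by
    simp [Finset.prod_ne_zero_iff, Polynomial.X_sub_C_ne_zero])]
  simp [Multiset.bind_singleton]

/-- The trace norm of a Hermitian matrix is the sum of the absolute values of its eigenvalues. -/
theorem traceNorm_inFrame {W : Matrix ι ι ℂ} (hW : IsUnitaryMat W) (d : ι → ℝ) :
    traceNorm (inFrame W d) = ∑ i, |d i| := by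
  have hsq : (inFrame W d)ᴴ * inFrame W d = inFrame W (fun i => d i * d i) := by
    rw [(isHermitian_inFrame W d).eq, inFrame_mul hW]
  -- The eigenvalues inside `traceNorm` come in an ordering unrelated to `d`, so the two lists are
  -- compared as multisets of roots of the characteristic polynomial.
  have hroots := (Matrix.isHermitian_conjTranspose_mul_self
    (inFrame W d)).roots_charpoly_eq_eigenvalues
  have hchar : ((inFrame W d)ᴴ * inFrame W d).charpoly =
      (realDiag (fun i => d i * d i)).charpoly := by
    rw [hsq, inFrame, Matrix.mul_assoc, Matrix.charpoly_mul_comm, Matrix.mul_assoc, hW.2,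
      Matrix.mul_one]
  rw [hchar, roots_charpoly_realDiag] at hroots
  have h := congrArg (fun s : Multiset ℂ => (s.map fun z => √z.re).sum) hroots
  simp only [Multiset.map_map, Function.comp_def, Complex.ofReal_re, RCLike.ofReal_eq_complex_ofReal]
    at h
  unfold traceNorm
  refine Eq.trans h.symm ?_
  exact Finset.sum_congr rfl fun i _ => Real.sqrt_mul_self_eq_abs _

/-- An effect distinguishes two density operators at most as well as their trace distance. -/
theorem trace_effect_sub_le_traceDist {Q ρ σ : Matrix ι ι ℂ} (h0 : Q.PosSemidef)
    (h1 : (1 - Q).PosSemidef) (hρ : ρ.IsHermitian) (hσ : σ.IsHermitian)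
    (htr : ρ.trace = σ.trace) :
    (Q * σ).trace.re - (Q * ρ).trace.re ≤ traceDist ρ σ := by
  obtain ⟨W, hW, d, hd⟩ := exists_inFrame_of_commute (fun _ : Unit => ρ - σ)
    (fun _ => hρ.sub hσ) (fun _ _ => Commute.refl _)
  have hd := hd ()
  set x := d ()
  have hsum : ∑ i, x i = 0 := by
    have h := trace_inFrame hW x
    rw [← hd, Matrix.trace_sub, htr, sub_self] at h
    exact_mod_cast h.symm
  have hle : (Q * σ).trace.re - (Q * ρ).trace.re = -∑ i, ((Wᴴ * Q * W) i i).re * x i := by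
    rw [← trace_mul_inFrame, ← hd, Matrix.mul_sub, Matrix.trace_sub, Complex.sub_re]
    ring
  rw [hle, traceDist, hd, traceNorm_inFrame hW]
  -- Termwise, the best weight in `[0, 1]` for `-x` picks its positive part. Since `x` sums to zero,
  -- the positive parts add up to half of the trace norm.
  have : -∑ i, ((Wᴴ * Q * W) i i).re * x i ≤ ∑ i, (1 / 2) * (|x i| - x i) := by
    rw [← Finset.sum_neg_distrib]
    refine Finset.sum_le_sum fun i _ => ?_
    obtain ⟨ha, hb⟩ := effect_diag_mem hW h0 h1 i
    rcases abs_cases (x i) with ⟨h, h'⟩ | ⟨h, h'⟩ <;> rw [h] <;> nlinarith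
  rwa [← Finset.mul_sum, Finset.sum_sub_distrib, hsum, sub_zero] at this

-- Duality between the partial trace and `Q ↦ Q ⊗ 1`; this starts the pullback of a test on the
-- output.
omit [DecidableEq κ] in
theorem trace_mul_partialTrace (Q : Matrix κ κ ℂ) (X : Matrix (κ × α) (κ × α) ℂ) :
    (Q * partialTrace X).trace = ((Q ⊗ₖ (1 : Matrix α α ℂ)) * X).trace := by
  simp only [Matrix.trace, Matrix.diag_apply, Matrix.mul_apply, partialTrace, Matrix.of_apply,
    Fintype.sum_prod_type, Matrix.kroneckerMap_apply, Matrix.one_apply]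
  simp only [mul_ite, mul_one, mul_zero, ite_mul, zero_mul, Finset.sum_ite_eq, Finset.mem_univ,
    if_true, Finset.mul_sum]
  exact Finset.sum_congr rfl fun i _ => Finset.sum_comm

theorem trace_partialTrace (X : Matrix (κ × α) (κ × α) ℂ) :
    (partialTrace X).trace = X.trace := by
  have h := trace_mul_partialTrace 1 X
  rwa [Matrix.one_kronecker_one, Matrix.one_mul, Matrix.one_mul] at h

omit [Fintype κ] [DecidableEq κ] [DecidableEq α] in
theorem isHermitian_partialTrace {X : Matrix (κ × α) (κ × α) ℂ} (hX : X.IsHermitian) :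
    (partialTrace X).IsHermitian := by
  ext i j
  simp only [partialTrace, Matrix.conjTranspose_apply, Matrix.of_apply, star_sum]
  exact Finset.sum_congr rfl fun a _ => hX.apply _ _

end LinearAlgebra

/-! ### Joint eigenbases, equilibrium distributions and classical hypothesis tests. -/

section Frames

variable {ι κ α : Type} [Fintype ι] [DecidableEq ι] [Fintype κ] [DecidableEq κ]
  [Fintype α] [DecidableEq α]

/-- The columns of `W` form an orthonormal basis of joint eigenvectors of `H` and `N`, with
eigenvalues `e` and `n`. -/
structure SysFrame (A : GPSystem ι) (W : Matrix ι ι ℂ) (e n : ι → ℝ) : Prop where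
  unitary : IsUnitaryMat W
  H_eq : A.H = inFrame W e
  N_eq : A.N = inFrame W n

/-- The columns of `W` form an orthonormal basis of joint eigenvectors of `ρ`, `H` and `N`, with
eigenvalues `r`, `e` and `n`. -/
structure StateFrame (R : GPState ι) (W : Matrix ι ι ℂ) (r e n : ι → ℝ) : Prop extends
    SysFrame R.toGPSystem W e n where
  ρ_eq : R.ρ = inFrame W r

theorem GPSystem.exists_frame (A : GPSystem ι) :
    ∃ (W : Matrix ι ι ℂ) (e n : ι → ℝ), SysFrame A W e n := by
  obtain ⟨W, hW, d, hd⟩ := exists_inFrame_of_commute (fun b : Bool => if b then A.H else A.N)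
    (fun b => by cases b <;> simp [A.isHermitian_H, A.isHermitian_N])
    (fun b b' => by cases b <;> cases b' <;> simp [A.commute_HN, A.commute_HN.symm])
  exact ⟨W, d true, d false, hW, by simpa using hd true, by simpa using hd false⟩

/-- This is where commutation makes the problem classical: everything after it is expressed through
the three real vectors. -/
theorem GPState.exists_frame (R : GPState ι) :
    ∃ (W : Matrix ι ι ℂ) (r e n : ι → ℝ), StateFrame R W r e n := by
  obtain ⟨W, hW, d, hd⟩ := exists_inFrame_of_commute ![R.ρ, R.H, R.N]
    (fun t => by
      fin_cases t
      exacts [R.posSemidef_ρ.isHermitian, R.isHermitian_H, R.isHermitian_N])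
    (fun s t => by
      fin_cases s <;> fin_cases t
      exacts [Commute.refl _, R.commute_ρH, R.commute_ρN, R.commute_ρH.symm, Commute.refl _,
        R.commute_HN, R.commute_ρN.symm, R.commute_HN.symm, Commute.refl _])
  exact ⟨W, d 0, d 1, d 2, ⟨hW, hd 1, hd 2⟩, hd 0⟩

theorem SysFrame.add {A : GPSystem ι} {B : GPSystem κ} {W : Matrix ι ι ℂ} {W' : Matrix κ κ ℂ}
    {e n : ι → ℝ} {e' n' : κ → ℝ} (hA : SysFrame A W e n) (hB : SysFrame B W' e' n') :
    SysFrame (A.add B) (W ⊗ₖ W') (fun p => e p.1 + e' p.2) (fun p => n p.1 + n' p.2) where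
  unitary := hA.unitary.kronecker hB.unitary
  H_eq := by
    rw [← kronSum_inFrame hA.unitary hB.unitary, ← hA.H_eq, ← hB.H_eq]
    rfl
  N_eq := by
    rw [← kronSum_inFrame hA.unitary hB.unitary, ← hA.N_eq, ← hB.N_eq]
    rfl

theorem StateFrame.add {R : GPState ι} {S : GPState κ} {W : Matrix ι ι ℂ} {W' : Matrix κ κ ℂ}
    {r e n : ι → ℝ} {r' e' n' : κ → ℝ} (hR : StateFrame R W r e n)
    (hS : StateFrame S W' r' e' n') :
    StateFrame (R.add S) (W ⊗ₖ W') (fun p => r p.1 * r' p.2) (fun p => e p.1 + e' p.2)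
      (fun p => n p.1 + n' p.2) where
  toSysFrame := hR.toSysFrame.add hS.toSysFrame
  ρ_eq := by
    rw [← inFrame_kronecker, ← hR.ρ_eq, ← hS.ρ_eq]
    rfl

theorem StateFrame.nonneg {R : GPState ι} {W : Matrix ι ι ℂ} {r e n : ι → ℝ}
    (hR : StateFrame R W r e n) (i : ι) : 0 ≤ r i :=
  (posSemidef_inFrame_iff hR.unitary).mp (hR.ρ_eq ▸ R.posSemidef_ρ) i

theorem StateFrame.sum_eq_one {R : GPState ι} {W : Matrix ι ι ℂ} {r e n : ι → ℝ}
    (hR : StateFrame R W r e n) : ∑ i, r i = 1 := by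
  have h := R.trace_ρ
  rw [hR.ρ_eq, trace_inFrame hR.unitary] at h
  exact_mod_cast h

theorem battery_frame (B : Battery) (E : B.levels) :
    StateFrame (B.state E) 1 (Pi.single E 1) (fun e => (e : ℝ)) (fun _ => B.number) where
  unitary := isUnitaryMat_one
  H_eq := by simp [inFrame, realDiag, Battery.state, Battery.sys]
  N_eq := by simp [inFrame, realDiag, Battery.state, Battery.sys]
  ρ_eq := by
    simp only [inFrame, realDiag, Battery.state, Matrix.one_mul, Matrix.conjTranspose_one,
      Matrix.mul_one]
    congr 1
    ext e
    by_cases h : e = E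
    · subst h; simp
    · simp [h]

/-- The Boltzmann factor of a level. -/
def boltzFactor (β μ : ℝ) (e n : ι → ℝ) (i : ι) : ℝ := Real.exp (-(β * (e i - μ * n i)))

/-- The partition function. -/
def partFun (β μ : ℝ) (e n : ι → ℝ) : ℝ := ∑ i, boltzFactor β μ e n i

/-- The equilibrium probability of a level. -/
def gibbs (β μ : ℝ) (e n : ι → ℝ) (i : ι) : ℝ := boltzFactor β μ e n i / partFun β μ e n

omit [Fintype ι] [DecidableEq ι] in
theorem boltzFactor_pos (β μ : ℝ) (e n : ι → ℝ) (i : ι) : 0 < boltzFactor β μ e n i :=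
  Real.exp_pos _

omit [DecidableEq ι] in
theorem partFun_pos [Nonempty ι] (β μ : ℝ) (e n : ι → ℝ) : 0 < partFun β μ e n :=
  Finset.sum_pos (fun i _ => boltzFactor_pos β μ e n i) Finset.univ_nonempty

omit [DecidableEq ι] in
theorem gibbs_pos [Nonempty ι] (β μ : ℝ) (e n : ι → ℝ) (i : ι) : 0 < gibbs β μ e n i :=
  div_pos (boltzFactor_pos β μ e n i) (partFun_pos β μ e n)

omit [DecidableEq ι] in
theorem sum_gibbs [Nonempty ι] (β μ : ℝ) (e n : ι → ℝ) : ∑ i, gibbs β μ e n i = 1 := by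
  unfold gibbs
  rw [← Finset.sum_div]
  exact div_self (partFun_pos β μ e n).ne'

omit [Fintype ι] [DecidableEq ι] [Fintype κ] [DecidableEq κ] in
theorem boltzFactor_add (β μ : ℝ) (e n : ι → ℝ) (e' n' : κ → ℝ) (p : ι × κ) :
    boltzFactor β μ (fun p : ι × κ => e p.1 + e' p.2) (fun p => n p.1 + n' p.2) p =
      boltzFactor β μ e n p.1 * boltzFactor β μ e' n' p.2 := by
  unfold boltzFactor
  rw [← Real.exp_add]
  congr 1
  ring

omit [DecidableEq ι] [DecidableEq κ] in
theorem partFun_add (β μ : ℝ) (e n : ι → ℝ) (e' n' : κ → ℝ) :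
    partFun β μ (fun p : ι × κ => e p.1 + e' p.2) (fun p => n p.1 + n' p.2) =
      partFun β μ e n * partFun β μ e' n' := by
  unfold partFun
  simp only [boltzFactor_add, Fintype.sum_prod_type]
  rw [Finset.sum_mul_sum]

omit [DecidableEq ι] [DecidableEq κ] in
theorem gibbs_add (β μ : ℝ) (e n : ι → ℝ) (e' n' : κ → ℝ) (p : ι × κ) :
    gibbs β μ (fun p : ι × κ => e p.1 + e' p.2) (fun p => n p.1 + n' p.2) p =
      gibbs β μ e n p.1 * gibbs β μ e' n' p.2 := by
  unfold gibbs
  rw [boltzFactor_add, partFun_add, mul_div_mul_comm]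

theorem boltzmann_eq_inFrame (β μ : ℝ) {A : GPSystem ι} {W : Matrix ι ι ℂ} {e n : ι → ℝ}
    (hA : SysFrame A W e n) : boltzmann β μ A = inFrame W (boltzFactor β μ e n) := by
  have hinv : W⁻¹ = Wᴴ := Matrix.inv_eq_right_inv hA.unitary.1
  have hunit : IsUnit W := IsUnit.of_mul_eq_one _ hA.unitary.1
  have h1 : (-β) • (A.H - μ • A.N) = W * realDiag (fun i => -(β * (e i - μ * n i))) * W⁻¹ := by
    rw [hA.H_eq, hA.N_eq, inFrame_smul, inFrame_sub, inFrame_smul, hinv, inFrame]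
    simp only [neg_mul]
  rw [boltzmann, h1, Matrix.exp_conj _ _ hunit, realDiag, Matrix.exp_diagonal, hinv, inFrame,
    realDiag]
  congr 3
  ext i
  rw [Pi.coe_exp]
  simp [boltzFactor, Complex.exp_eq_exp_ℂ]

theorem freeState_eq_inFrame [Nonempty ι] (β μ : ℝ) {A : GPSystem ι} {W : Matrix ι ι ℂ}
    {e n : ι → ℝ} (hA : SysFrame A W e n) :
    (freeState β μ A).ρ = inFrame W (gibbs β μ e n) := by
  have h : (freeState β μ A).ρ = (boltzmann β μ A).trace⁻¹ • boltzmann β μ A := rfl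
  rw [h, boltzmann_eq_inFrame β μ hA, trace_inFrame hA.unitary]
  have : ((∑ i, boltzFactor β μ e n i : ℝ) : ℂ)⁻¹ • inFrame W (boltzFactor β μ e n) =
      (partFun β μ e n)⁻¹ • inFrame W (boltzFactor β μ e n) := by
    rw [← Complex.ofReal_inv]
    rfl
  rw [this, inFrame_smul]
  congr 1
  ext i
  rw [gibbs, div_eq_inv_mul]

/-- A unitary that carries one Hamiltonian and number operator to another also carries the
equilibrium operators to each other. -/
theorem conj_boltzmann (β μ : ℝ) {X : GPSystem ι} {Y : GPSystem κ} {V : Matrix κ ι ℂ}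
    (hV : IsUnitaryMat V) (hH : V * X.H * Vᴴ = Y.H) (hN : V * X.N * Vᴴ = Y.N) :
    V * boltzmann β μ X * Vᴴ = boltzmann β μ Y := by
  obtain ⟨W, e, n, hX⟩ := X.exists_frame
  obtain ⟨W', e', n', hY⟩ := Y.exists_frame
  have key : ∀ d d', V * inFrame W d * Vᴴ = inFrame W' d' →
      (W'ᴴ * V * W) * realDiag d = realDiag d' * (W'ᴴ * V * W) := by
    intro d d' h
    have h1 : W'ᴴ * (V * inFrame W d * Vᴴ) * (V * W) = W'ᴴ * inFrame W' d' * (V * W) := by rw [h]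
    have h2 : W'ᴴ * (V * inFrame W d * Vᴴ) * (V * W) = (W'ᴴ * V * W) * realDiag d := by
      have : W'ᴴ * (V * inFrame W d * Vᴴ) * (V * W) =
          W'ᴴ * V * W * realDiag d * (Wᴴ * (Vᴴ * V) * W) := by
        simp only [inFrame, Matrix.mul_assoc]
      rw [this, hV.2, Matrix.mul_one, hX.unitary.2, Matrix.mul_one]
    have h3 : W'ᴴ * inFrame W' d' * (V * W) = realDiag d' * (W'ᴴ * V * W) := by
      have : W'ᴴ * inFrame W' d' * (V * W) = (W'ᴴ * W') * (realDiag d' * (W'ᴴ * V * W)) := by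
        simp only [inFrame, Matrix.mul_assoc]
      rw [this, hY.unitary.2, Matrix.one_mul]
    rw [← h2, h1, h3]
  have hH' := key e e' (by rw [← hX.H_eq, ← hY.H_eq, hH])
  have hN' := key n n' (by rw [← hX.N_eq, ← hY.N_eq, hN])
  -- The intertwining relations say that a nonzero entry of `W'ᴴ * V * W` joins levels with equal
  -- energy and equal number, so it intertwines every function of these two as well.
  have hB : (W'ᴴ * V * W) * realDiag (boltzFactor β μ e n) =
      realDiag (boltzFactor β μ e' n') * (W'ᴴ * V * W) := by
    ext j i
    have h1 := congrFun (congrFun hH' j) i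
    have h2 := congrFun (congrFun hN' j) i
    simp only [realDiag, Matrix.mul_diagonal, Matrix.diagonal_mul] at h1 h2 ⊢
    by_cases hM : (W'ᴴ * V * W) j i = 0
    · simp [hM]
    · rw [mul_comm] at h1 h2 ⊢
      have he : e i = e' j := by exact_mod_cast mul_right_cancel₀ hM h1
      have hn : n i = n' j := by exact_mod_cast mul_right_cancel₀ hM h2
      simp [boltzFactor, he, hn]
  rw [boltzmann_eq_inFrame β μ hX, boltzmann_eq_inFrame β μ hY]
  calc V * inFrame W (boltzFactor β μ e n) * Vᴴ
      = (W' * W'ᴴ) * (V * inFrame W (boltzFactor β μ e n) * Vᴴ) := by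
        rw [hY.unitary.1, Matrix.one_mul]
    _ = W' * ((W'ᴴ * V * W) * realDiag (boltzFactor β μ e n)) * (Wᴴ * Vᴴ) := by
        simp only [inFrame, Matrix.mul_assoc]
    _ = W' * realDiag (boltzFactor β μ e' n') * (W'ᴴ * (V * (W * Wᴴ) * Vᴴ)) := by
        rw [hB]; simp only [Matrix.mul_assoc]
    _ = inFrame W' (boltzFactor β μ e' n') := by
        rw [hX.unitary.1, Matrix.mul_one, hV.1, Matrix.mul_one, inFrame]

/-- In the eigenbasis of commuting `ρ` and `σ`, the optimal type II error is that of a classical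
hypothesis test, and it is attained. -/
theorem typeIIError_le_iff {W : Matrix ι ι ℂ} (hW : IsUnitaryMat W) {r g : ι → ℝ}
    (hr : ∑ i, r i = 1) (hg : ∀ i, 0 ≤ g i) {ε : ℝ} (hε : 0 ≤ ε) (b : ℝ) :
    typeIIError ε (inFrame W r) (inFrame W g) ≤ b ↔
      ∃ q : ι → ℝ, (∀ i, q i ∈ Set.Icc (0 : ℝ) 1) ∧ 1 - ε ≤ ∑ i, q i * r i ∧
        ∑ i, q i * g i ≤ b := by
  have hnn : ∀ Q : Matrix ι ι ℂ, Q.PosSemidef → (1 - Q).PosSemidef →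
      0 ≤ (Q * inFrame W g).trace.re := fun Q h0 h1 => by
    rw [trace_mul_inFrame]
    exact Finset.sum_nonneg fun i _ => mul_nonneg (effect_diag_mem hW h0 h1 i).1 (hg i)
  have hmem : ∀ q : ι → ℝ, (∀ i, q i ∈ Set.Icc (0 : ℝ) 1) → 1 - ε ≤ ∑ i, q i * r i →
      ∑ i, q i * g i ∈ {b : ℝ | ∃ Q : Matrix ι ι ℂ, Q.PosSemidef ∧ (1 - Q).PosSemidef ∧
        1 - ε ≤ (Q * inFrame W r).trace.re ∧ b = (Q * inFrame W g).trace.re} := by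
    intro q hq hqr
    refine ⟨inFrame W q, posSemidef_inFrame W fun i => (hq i).1,
      one_sub_inFrame_posSemidef hW fun i => (hq i).2, ?_, ?_⟩
    · rwa [trace_inFrame_mul_inFrame hW]
    · rw [trace_inFrame_mul_inFrame hW]
  constructor
  · intro h
    -- The diagonal of any admissible effect lies in this compact set and has the same two traces,
    -- so the infimum is a minimum over classical tests.
    let K : Set (ι → ℝ) := Set.pi Set.univ (fun _ => Set.Icc (0 : ℝ) 1) ∩
      {q | 1 - ε ≤ ∑ i, q i * r i}
    have hK : IsCompact K := (isCompact_univ_pi fun _ => isCompact_Icc).inter_right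
      (isClosed_le continuous_const (by fun_prop))
    have h1K : (fun _ => 1) ∈ K := by
      refine ⟨fun i _ => by simp, ?_⟩
      simp only [Set.mem_ofPred_eq, one_mul, hr]
      linarith
    obtain ⟨q, hqK, hqmin⟩ := hK.exists_isMinOn ⟨_, h1K⟩
      (f := fun q : ι → ℝ => ∑ i, q i * g i) (by fun_prop)
    refine ⟨q, fun i => hqK.1 i (Set.mem_univ i), hqK.2, le_trans ?_ h⟩
    refine le_csInf ⟨_, hmem (fun _ => 1) (fun i => by simp) h1K.2⟩ ?_
    rintro _ ⟨Q, h0, h1, h2, rfl⟩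
    rw [trace_mul_inFrame] at h2 ⊢
    exact hqmin ⟨fun i _ => effect_diag_mem hW h0 h1 i, h2⟩
  · rintro ⟨q, hq, hqr, hqg⟩
    refine le_trans (csInf_le ⟨0, ?_⟩ (hmem q hq hqr)) hqg
    rintro _ ⟨Q, h0, h1, -, rfl⟩
    exact hnn Q h0 h1

end Frames

/-! ### Necessary conditions: pulling tests back through equilibrating operations. -/

section Necessity

variable {ι κ : Type} [Fintype ι] [DecidableEq ι] [Fintype κ] [DecidableEq κ]

theorem posSemidef_kronecker_one_test {α : Type} [Fintype α] [DecidableEq α] {Q : Matrix κ κ ℂ}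
    (h0 : Q.PosSemidef) (h1 : (1 - Q).PosSemidef) :
    (Q ⊗ₖ (1 : Matrix α α ℂ)).PosSemidef ∧ (1 - Q ⊗ₖ (1 : Matrix α α ℂ)).PosSemidef := by
  refine ⟨h0.kronecker Matrix.PosSemidef.one, ?_⟩
  have : (1 : Matrix (κ × α) (κ × α) ℂ) - Q ⊗ₖ (1 : Matrix α α ℂ) = (1 - Q) ⊗ₖ 1 := by
    rw [eq_comm, eq_sub_iff_add_eq, ← Matrix.add_kronecker, sub_add_cancel, Matrix.one_kronecker_one]
  rw [this]
  exact h1.kronecker Matrix.PosSemidef.one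

theorem IsEquilibratingOutput.isHermitian {β μ : ℝ} {R : GPState ι} {S : GPSystem κ}
    {σ : Matrix κ κ ℂ} (h : IsEquilibratingOutput β μ R S σ) : σ.IsHermitian := by
  obtain ⟨n, m, G, A, U, V, -, -, rfl⟩ := h
  refine isHermitian_partialTrace (Matrix.isHermitian_mul_mul_conjTranspose V ?_)
  exact Matrix.isHermitian_mul_mul_conjTranspose U (GPState.posSemidef_ρ _).isHermitian

theorem IsEquilibratingOutput.trace {β μ : ℝ} {R : GPState ι} {S : GPSystem κ}
    {σ : Matrix κ κ ℂ} (h : IsEquilibratingOutput β μ R S σ) : σ.trace = 1 := by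
  obtain ⟨n, m, G, A, U, V, hU, hV, rfl⟩ := h
  rw [trace_partialTrace, Matrix.trace_mul_comm, ← Matrix.mul_assoc, hV.2.1, Matrix.one_mul,
    Matrix.trace_mul_comm, ← Matrix.mul_assoc, hU.2.1, Matrix.one_mul, GPState.trace_ρ]

/-- Heisenberg picture of an equilibrating operation: every classical test on the output pulls
back to a classical test on the input with the same equilibrium expectation. -/
theorem IsEquilibratingOutput.pullback [Nonempty ι] {β μ : ℝ} {R : GPState ι}
    {S : GPSystem κ} {σ : Matrix κ κ ℂ} (h : IsEquilibratingOutput β μ R S σ)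
    {W : Matrix ι ι ℂ} {r e n : ι → ℝ} (hR : StateFrame R W r e n)
    {W' : Matrix κ κ ℂ} {e' n' : κ → ℝ} (hS : SysFrame S W' e' n')
    {q : κ → ℝ} (hq : ∀ y, q y ∈ Set.Icc (0 : ℝ) 1) :
    ∃ q' : ι → ℝ, (∀ x, q' x ∈ Set.Icc (0 : ℝ) 1) ∧
      ∑ x, q' x * gibbs β μ e n x = ∑ y, q y * gibbs β μ e' n' y ∧
      ∑ x, q' x * r x = (inFrame W' q * σ).trace.re := by
  obtain ⟨k, m, G, A, U, V, ⟨hU1, hU2, hUH, hUN⟩, ⟨hV1, hV2, hVH, hVN⟩, rfl⟩ := h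
  obtain ⟨WG, eG, nG, hG⟩ := G.exists_frame
  obtain ⟨WA, eA, nA, hA⟩ := A.exists_frame
  have hV : IsUnitaryMat V := ⟨hV1, hV2⟩
  have hU : IsUnitaryMat U := ⟨hU1, hU2⟩
  have hRG := hR.toSysFrame.add hG
  have hSA := hS.add hA
  set T := inFrame W' q ⊗ₖ (1 : Matrix (Fin m) (Fin m) ℂ) with hT
  set P := (V * U)ᴴ * T * (V * U) with hP
  have hVU := hV.mul hU
  obtain ⟨hT0, hT1⟩ := posSemidef_kronecker_one_test (α := Fin m)
    (posSemidef_inFrame W' fun i => (hq i).1)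
    (one_sub_inFrame_posSemidef hS.unitary fun i => (hq i).2)
  have hP0 : P.PosSemidef := hT0.conjTranspose_mul_mul_same _
  have hP1 : (1 - P).PosSemidef := by
    have := hT1.conjTranspose_mul_mul_same (V * U)
    rwa [Matrix.mul_sub, Matrix.sub_mul, Matrix.mul_one, hVU.2] at this
  have hcyc : ∀ X : Matrix (ι × Fin (k + 1)) (ι × Fin (k + 1)) ℂ,
      (T * (V * (U * X * Uᴴ) * Vᴴ)).trace = (P * X).trace := by
    intro X
    have h1 : T * (V * (U * X * Uᴴ) * Vᴴ) = (T * (V * U) * X) * (V * U)ᴴ := by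
      rw [Matrix.conjTranspose_mul]
      simp only [Matrix.mul_assoc]
    rw [h1, Matrix.trace_mul_comm, hP]
    simp only [Matrix.mul_assoc]
  set p : ι × Fin (k + 1) → ℝ :=
    fun z => (((W ⊗ₖ WG)ᴴ * P * (W ⊗ₖ WG)) z z).re with hp
  have hp01 : ∀ z, p z ∈ Set.Icc (0 : ℝ) 1 := fun z => effect_diag_mem hRG.unitary hP0 hP1 z
  have hgG := gibbs_pos β μ eG nG
  have hsG := sum_gibbs β μ eG nG
  have hconj : V * (U * boltzmann β μ (R.toGPSystem.add G) * Uᴴ) * Vᴴ =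
      boltzmann β μ (S.add A) := by
    have hc : Commute U (boltzmann β μ (R.toGPSystem.add G)) := by
      have h1 : Commute U ((R.toGPSystem.add G).H - μ • (R.toGPSystem.add G).N) :=
        Commute.sub_right hUH (Commute.smul_right hUN μ)
      exact (h1.smul_right (-β)).exp_right
    rw [hc.eq, Matrix.mul_assoc _ U, hU1, Matrix.mul_one]
    exact conj_boltzmann β μ hV hVH hVN
  -- Equality of the total partition functions turns the balance of Boltzmann weights below into one
  -- of normalized equilibrium distributions.
  have hZ : partFun β μ e n * partFun β μ eG nG = partFun β μ e' n' * partFun β μ eA nA := by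
    have h1 := congrArg Matrix.trace hconj
    rw [Matrix.trace_mul_comm, ← Matrix.mul_assoc, hV2, Matrix.one_mul, Matrix.trace_mul_comm,
      ← Matrix.mul_assoc, hU2, Matrix.one_mul, boltzmann_eq_inFrame β μ hRG,
      boltzmann_eq_inFrame β μ hSA, trace_inFrame hRG.unitary, trace_inFrame hSA.unitary] at h1
    rw [← partFun_add, ← partFun_add]
    exact_mod_cast h1
  have hbal : ∑ z, p z * boltzFactor β μ (fun z => e z.1 + eG z.2) (fun z => n z.1 + nG z.2) z =
      (∑ y, q y * boltzFactor β μ e' n' y) * partFun β μ eA nA := by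
    have h1 : (P * boltzmann β μ (R.toGPSystem.add G)).trace.re =
        (T * boltzmann β μ (S.add A)).trace.re := by
      rw [← hconj, hcyc]
    rw [boltzmann_eq_inFrame β μ hRG, trace_mul_inFrame, boltzmann_eq_inFrame β μ hSA, hT,
      ← inFrame_one hA.unitary, inFrame_kronecker, trace_inFrame_mul_inFrame hSA.unitary] at h1
    rw [h1, Fintype.sum_prod_type, Finset.sum_mul]
    refine Finset.sum_congr rfl fun y _ => ?_
    rw [partFun, Finset.mul_sum]
    refine Finset.sum_congr rfl fun a _ => ?_
    rw [boltzFactor_add]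
    ring
  -- The test on the input is the diagonal of the Heisenberg-evolved test, averaged over the
  -- equilibrium distribution of the bath.
  refine ⟨fun x => ∑ g, p (x, g) * gibbs β μ eG nG g, fun x => ⟨?_, ?_⟩, ?_, ?_⟩
  · exact Finset.sum_nonneg fun g _ => mul_nonneg (hp01 _).1 (hgG g).le
  · rw [← hsG]
    exact Finset.sum_le_sum fun g _ => mul_le_of_le_one_left (hgG g).le (hp01 _).2
  · have hZR := partFun_pos β μ e n
    have hZG := partFun_pos β μ eG nG
    -- Neither the output nor the discarded system is assumed to have a level; that their partition
    -- functions do not vanish is read off from the input side.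
    have hZne : partFun β μ e' n' * partFun β μ eA nA ≠ 0 := hZ ▸ (mul_pos hZR hZG).ne'
    have h1 : ∑ x, (∑ g, p (x, g) * gibbs β μ eG nG g) * gibbs β μ e n x =
        (∑ z, p z * boltzFactor β μ (fun z => e z.1 + eG z.2) (fun z => n z.1 + nG z.2) z) /
          (partFun β μ e n * partFun β μ eG nG) := by
      rw [Fintype.sum_prod_type, Finset.sum_div]
      refine Finset.sum_congr rfl fun x _ => ?_
      rw [Finset.sum_mul, Finset.sum_div]
      refine Finset.sum_congr rfl fun g _ => ?_
      rw [boltzFactor_add, gibbs, gibbs]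
      field_simp
    rw [h1, hbal, hZ, mul_div_mul_right _ _ (right_ne_zero_of_mul hZne), Finset.sum_div]
    exact Finset.sum_congr rfl fun y _ => by rw [gibbs, mul_div_assoc]
  · have hρ : (R.add (freeState β μ G)).ρ =
        inFrame (W ⊗ₖ WG) (fun z => r z.1 * gibbs β μ eG nG z.2) := by
      rw [← inFrame_kronecker, ← hR.ρ_eq, ← freeState_eq_inFrame β μ hG]
      rfl
    rw [trace_mul_partialTrace, hcyc, hρ, trace_mul_inFrame, Fintype.sum_prod_type]
    refine Finset.sum_congr rfl fun x _ => ?_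
    rw [Finset.sum_mul]
    exact Finset.sum_congr rfl fun g _ => by rw [hp]; ring

/-- The equilibrium expectation survives exactly, because it does not involve the state;
approximation costs only `ε` in the expectation on `r`. -/
theorem ReachesApprox.pullback [Nonempty ι] {β μ ε : ℝ} {R : GPState ι} {S : GPState κ}
    (h : ReachesApprox β μ ε R S) {W : Matrix ι ι ℂ} {r e n : ι → ℝ}
    (hR : StateFrame R W r e n) {W' : Matrix κ κ ℂ} {s e' n' : κ → ℝ}
    (hS : StateFrame S W' s e' n') {q : κ → ℝ} (hq : ∀ y, q y ∈ Set.Icc (0 : ℝ) 1) :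
    ∃ q' : ι → ℝ, (∀ x, q' x ∈ Set.Icc (0 : ℝ) 1) ∧
      ∑ x, q' x * gibbs β μ e n x = ∑ y, q y * gibbs β μ e' n' y ∧
      ∑ y, q y * s y - ε ≤ ∑ x, q' x * r x := by
  obtain ⟨S', ⟨hsys, hdist⟩, hreach⟩ := h
  have hQ0 := posSemidef_inFrame W' fun i => (hq i).1
  have hQ1 := one_sub_inFrame_posSemidef hS.unitary fun i => (hq i).2
  have h1 := trace_effect_sub_le_traceDist hQ0 hQ1 S'.posSemidef_ρ.isHermitian
    S.posSemidef_ρ.isHermitian (S'.trace_ρ.trans S.trace_ρ.symm)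
  rw [hS.ρ_eq, trace_inFrame_mul_inFrame hS.unitary, ← hS.ρ_eq] at h1
  set c := ∑ y, q y * gibbs β μ e' n' y
  have happrox : ∀ η : ℝ, 0 < η → ∃ q' : ι → ℝ, (∀ x, q' x ∈ Set.Icc (0 : ℝ) 1) ∧
      ∑ x, q' x * gibbs β μ e n x = c ∧ ∑ y, q y * s y - ε - η ≤ ∑ x, q' x * r x := by
    intro η hη
    obtain ⟨σ, hσ, hd⟩ := hreach η hη
    rw [hsys] at hσ
    obtain ⟨q', h01, hg, hr⟩ := hσ.pullback hR hS.toSysFrame hq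
    refine ⟨q', h01, hg, ?_⟩
    have h2 := trace_effect_sub_le_traceDist hQ0 hQ1 hσ.isHermitian
      S'.posSemidef_ρ.isHermitian (hσ.trace.trans S'.trace_ρ.symm)
    linarith
  -- Each precision `η` supplies its own test. A maximizer over this compact set is at least as good
  -- as all of them, so `η` drops out.
  let K : Set (ι → ℝ) := Set.pi Set.univ (fun _ => Set.Icc (0 : ℝ) 1) ∩
    {q' | ∑ x, q' x * gibbs β μ e n x = c}
  have hK : IsCompact K := (isCompact_univ_pi fun _ => isCompact_Icc).inter_right
    (isClosed_eq (by fun_prop) continuous_const)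
  obtain ⟨q₁, h01, hg, -⟩ := happrox 1 one_pos
  obtain ⟨q', hq'K, hmax⟩ := hK.exists_isMaxOn ⟨q₁, fun x _ => h01 x, hg⟩
    (f := fun q' : ι → ℝ => ∑ x, q' x * r x) (by fun_prop)
  refine ⟨q', fun x => hq'K.1 x (Set.mem_univ x), hq'K.2, le_of_forall_pos_le_add fun η hη => ?_⟩
  obtain ⟨q₂, h01', hg', hr'⟩ := happrox η hη
  have : ∑ x, q₂ x * r x ≤ ∑ x, q' x * r x := hmax ⟨fun x _ => h01' x, hg'⟩
  linarith

end Necessity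

/-! ### Permutations with prescribed joint counts. -/

section Counting

variable {S X Y τ : Type} [Fintype S] [Fintype X] [DecidableEq X] [Fintype Y]
  [DecidableEq Y]

/-- Two labellings of a finite set can be matched by a permutation that realizes prescribed joint
counts, provided the counts respect the sizes of the label classes. -/
theorem exists_perm_of_counts (a : S → X) (b : S → Y) (c : X → Y → ℕ)
    (hrow : ∀ x, ∑ y, c x y ≤ (Finset.univ.filter fun s => a s = x).card)
    (hcol : ∀ y, ∑ x, c x y ≤ (Finset.univ.filter fun s => b s = y).card) :
    ∃ φ : Equiv.Perm S, ∀ x y,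
      c x y ≤ (Finset.univ.filter fun s => a s = x ∧ b (φ s) = y).card := by
  have hf : ∀ x, Nonempty ((Σ y, Fin (c x y)) ↪ {s // a s = x}) := fun x =>
    Function.Embedding.nonempty_of_card_le (by
      simpa [Fintype.card_subtype] using hrow x)
  have hg : ∀ y, Nonempty ((Σ x, Fin (c x y)) ↪ {s // b s = y}) := fun y =>
    Function.Embedding.nonempty_of_card_le (by
      simpa [Fintype.card_subtype] using hcol y)
  let F : ∀ x, (Σ y, Fin (c x y)) ↪ {s // a s = x} := fun x => (hf x).some
  let G : ∀ y, (Σ x, Fin (c x y)) ↪ {s // b s = y} := fun y => (hg y).some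
  -- Tokens `(x, y, i)` are placed injectively twice: by `f'` in the class `a = x` and by `g'` in
  -- the class `b = y`. A permutation carrying the first placement to the second realizes the
  -- counts.
  let f' : (Σ x, Σ y, Fin (c x y)) → S := fun i => F i.1 i.2
  let g' : (Σ x, Σ y, Fin (c x y)) → S := fun i => G i.2.1 ⟨i.1, i.2.2⟩
  have hf' : Function.Injective f' := by
    rintro ⟨x, i⟩ ⟨x', i'⟩ h
    have hx : x = x' := by
      rw [← (F x i).2, ← (F x' i').2]
      exact congrArg a h
    subst hx
    have h2 : i = i' := (F x).injective (Subtype.ext h)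
    rw [h2]
  have hg' : Function.Injective g' := by
    rintro ⟨x, y, i⟩ ⟨x', y', i'⟩ h
    have hy : y = y' := by
      rw [← (G y ⟨x, i⟩).2, ← (G y' ⟨x', i'⟩).2]
      exact congrArg b h
    subst hy
    have := (G y).injective (Subtype.ext h)
    simp only [Sigma.mk.injEq] at this
    obtain ⟨rfl, h2⟩ := this
    rw [eq_of_heq h2]
  obtain ⟨φ, hφ⟩ := Equiv.Perm.exists_extending_pair f' g' hf' hg'
  refine ⟨φ, fun x y => ?_⟩
  have hcard := Finset.card_le_card_of_injOn (s := (Finset.univ : Finset (Fin (c x y))))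
    (t := Finset.univ.filter fun s => a s = x ∧ b (φ s) = y)
    (fun j => f' ⟨x, y, j⟩) (fun j _ => by
      simp only [Finset.coe_filter, Finset.mem_univ, true_and, Set.mem_ofPred_eq]
      exact ⟨(F x ⟨y, j⟩).2, by rw [hφ]; exact (G y ⟨x, j⟩).2⟩)
    (fun j _ j' _ h => by
      have := hf' h
      simpa using this)
  simpa using hcard

/-- A version of `exists_perm_of_counts` in which the permutation preserves a sector map and the
joint counts are prescribed in each sector. -/
theorem exists_perm_of_sector_counts [DecidableEq τ] (sec : S → τ) (a : S → X) (b : S → Y)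
    (c : τ → X → Y → ℕ)
    (hrow : ∀ t x, ∑ y, c t x y ≤ (Finset.univ.filter fun s => sec s = t ∧ a s = x).card)
    (hcol : ∀ t y, ∑ x, c t x y ≤ (Finset.univ.filter fun s => sec s = t ∧ b s = y).card) :
    ∃ φ : Equiv.Perm S, (∀ s, sec (φ s) = sec s) ∧ ∀ t x y,
      c t x y ≤ (Finset.univ.filter fun s => sec s = t ∧ a s = x ∧ b (φ s) = y).card := by
  have hcount : ∀ (t : τ) (p : S → Prop) [DecidablePred p],
      (Finset.univ.filter fun s : {s // sec s = t} => p s).card =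
        (Finset.univ.filter fun s => sec s = t ∧ p s).card := by
    intro t p _
    rw [← Finset.card_map (Function.Embedding.subtype fun s => sec s = t)]
    congr 1
    ext s
    simp [and_comm]
  have h : ∀ t, ∃ φ : Equiv.Perm {s // sec s = t}, ∀ x y, c t x y ≤
      (Finset.univ.filter fun s : {s // sec s = t} => a s = x ∧ b (φ s) = y).card := fun t =>
    exists_perm_of_counts (fun s : {s // sec s = t} => a s) (fun s => b s) (c t)
      (fun x => by rw [hcount t (fun s => a s = x)]; exact hrow t x)
      (fun y => by rw [hcount t (fun s => b s = y)]; exact hcol t y)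
  choose φ hφ using h
  let Φ : Equiv.Perm S := Equiv.ofFiberEquiv (f := sec) (g := sec) φ
  have hΦ : ∀ t (s : {s // sec s = t}), Φ s = φ t s := by
    rintro _ ⟨s, rfl⟩
    rfl
  refine ⟨Φ, fun s => Equiv.ofFiberEquiv_map φ s, fun t x y => (hφ t x y).trans ?_⟩
  rw [← hcount t (fun s => a s = x ∧ b (Φ s) = y)]
  simp only [hΦ]
  exact le_rfl

end Counting

/-! ### A reservoir with nearly uniform occupation numbers. -/

section Bath

variable {Z : Type} [Fintype Z]

/-- The value of an additive quantity `e` for given occupation numbers. -/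
def occValue (e : Z → ℝ) (t : Z → ℕ) : ℝ := ∑ z, t z * e z

/-- Levels of the reservoir: occupation numbers below `L`, each occurring `⌈C / w⌉` times if its
Boltzmann factor is `w`, so that all occupation numbers are almost equally likely. -/
abbrev Reservoir (β μ : ℝ) (e n : Z → ℝ) (L : ℕ) (C : ℝ) : Type :=
  Σ k : Z → Fin L, Fin ⌈C / boltzFactor β μ (occValue e) (occValue n) (fun z => (k z : ℕ))⌉₊

/-- The energy or number of particles of a reservoir level. -/
def reservoirValue {β μ : ℝ} {e n : Z → ℝ} {L : ℕ} {C : ℝ} (f : Z → ℝ)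
    (g : Reservoir β μ e n L C) : ℝ := occValue f (fun z => (g.1 z : ℕ))

/-- The total occupation numbers of a level of the system and a level of the reservoir. -/
def sector [DecidableEq Z] {β μ : ℝ} {e n : Z → ℝ} {L : ℕ} {C : ℝ}
    (s : Z × Reservoir β μ e n L C) : Z → ℕ :=
  fun z => (s.2.1 z : ℕ) + Pi.single (M := fun _ => ℕ) s.1 1 z

/-- The sector determines the total of every additive quantity, so preserving it conserves energy
and particle number at once. -/
theorem occValue_sector [DecidableEq Z] {β μ : ℝ} {e n : Z → ℝ} {L : ℕ} {C : ℝ} (f : Z → ℝ)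
    (s : Z × Reservoir β μ e n L C) :
    occValue f (sector s) = f s.1 + reservoirValue f s.2 := by
  unfold occValue reservoirValue sector occValue
  simp only [Nat.cast_add, add_mul, Finset.sum_add_distrib]
  rw [add_comm]
  congr 1
  rw [Finset.sum_eq_single s.1] <;> simp +contextual

/-- The weight of a sector factorizes. -/
theorem boltzFactor_sector [DecidableEq Z] {β μ : ℝ} {e n : Z → ℝ} {L : ℕ} {C : ℝ}
    (s : Z × Reservoir β μ e n L C) :
    boltzFactor β μ (occValue e) (occValue n) (sector s) =
      boltzFactor β μ e n s.1 *
        boltzFactor β μ (reservoirValue e) (reservoirValue n) s.2 := by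
  unfold boltzFactor
  rw [← Real.exp_add, occValue_sector, occValue_sector]
  congr 1
  ring

/-- In a sector without boundary effects, each system level occurs in proportion to its Boltzmann
factor, up to rounding. -/
theorem le_card_sector [DecidableEq Z] (β μ : ℝ) (e n : Z → ℝ) (L : ℕ) (C : ℝ) (t : Z → ℕ)
    (ht : ∀ z, t z ∈ Finset.Ico 1 L) (z : Z) :
    C * boltzFactor β μ e n z / boltzFactor β μ (occValue e) (occValue n) t ≤
      ((Finset.univ.filter fun s : Z × Reservoir β μ e n L C => sector s = t ∧ s.1 = z).card : ℝ)
      := by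
  have ht' : ∀ z, 1 ≤ t z ∧ t z < L := fun z => by simpa using ht z
  -- The reservoir must hold `t` minus one unit at `z`; `1 ≤ t z` makes the truncated subtraction
  -- exact, and `t < L` keeps the result in the box.
  let k : Z → Fin L := fun z' => ⟨t z' - Pi.single (M := fun _ => ℕ) z 1 z',
    lt_of_le_of_lt (Nat.sub_le _ _) (ht' z').2⟩
  set w := boltzFactor β μ (occValue e) (occValue n) (fun z => (k z : ℕ)) with hw
  have hsec : ∀ j, sector ((z, ⟨k, j⟩) : Z × Reservoir β μ e n L C) = t := by
    intro j
    funext z'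
    have h1 := (ht' z').1
    by_cases h : z' = z
    · subst h
      simp only [sector, k, Pi.single_eq_same]
      omega
    · simp [sector, k, h]
  have hmul : ∀ j : Fin ⌈C / w⌉₊, boltzFactor β μ (occValue e) (occValue n) t =
      boltzFactor β μ e n z * w := by
    intro j
    rw [← hsec j, boltzFactor_sector]
    rfl
  have hwpos : 0 < w := boltzFactor_pos _ _ _ _ _
  have hzpos := boltzFactor_pos β μ e n z
  have hcard := Finset.card_le_card_of_injOn (s := (Finset.univ : Finset (Fin ⌈C / w⌉₊)))
    (t := Finset.univ.filter fun s : Z × Reservoir β μ e n L C => sector s = t ∧ s.1 = z)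
    (fun j => (z, ⟨k, j⟩)) (fun j _ => by simp [hsec j])
    (fun j _ j' _ h => by simpa using h)
  rw [Finset.card_univ, Fintype.card_fin] at hcard
  refine le_trans ?_ (Nat.cast_le.mpr hcard)
  -- `hmul` factorizes the weight through an actual reservoir level, so the case without copies is
  -- separate; then `C ≤ 0`, and the bound is trivial.
  by_cases hj : ⌈C / w⌉₊ = 0
  · have hC : C / w ≤ 0 := Nat.ceil_eq_zero.mp hj
    have hC' : C ≤ 0 := by
      by_contra hlt
      exact absurd hC (not_le.mpr (div_pos (not_le.mp hlt) hwpos))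
    rw [hj, Nat.cast_zero]
    exact div_nonpos_of_nonpos_of_nonneg (mul_nonpos_of_nonpos_of_nonneg hC' hzpos.le)
      (boltzFactor_pos _ _ _ _ _).le
  · rw [hmul ⟨0, Nat.pos_of_ne_zero hj⟩, mul_comm, mul_div_mul_left _ _ hzpos.ne']
    exact Nat.le_ceil _

/-- The partition function of the reservoir. -/
theorem partFun_reservoir_le [DecidableEq Z] (β μ : ℝ) (e n : Z → ℝ) (L : ℕ) (C : ℝ) (hC : 0 ≤ C) :
    partFun β μ (reservoirValue e) (reservoirValue n : Reservoir β μ e n L C → ℝ) ≤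
      (L : ℝ) ^ Fintype.card Z * C +
        ∑ k : Z → Fin L, boltzFactor β μ (occValue e) (occValue n) (fun z => (k z : ℕ)) := by
  unfold partFun
  rw [Fintype.sum_sigma]
  have hcard : (L : ℝ) ^ Fintype.card Z * C = ∑ _k : Z → Fin L, C := by simp
  rw [hcard, ← Finset.sum_add_distrib]
  refine Finset.sum_le_sum fun k _ => ?_
  set w := boltzFactor β μ (occValue e) (occValue n) (fun z => (k z : ℕ)) with hw
  have hwpos : 0 < w := boltzFactor_pos _ _ _ _ _
  have : ∀ j : Fin ⌈C / w⌉₊, boltzFactor β μ (reservoirValue e) (reservoirValue n)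
      (⟨k, j⟩ : Reservoir β μ e n L C) = w := fun j => rfl
  simp only [this, Finset.sum_const, Finset.card_univ, Fintype.card_fin, nsmul_eq_mul]
  have h1 : (⌈C / w⌉₊ : ℝ) ≤ C / w + 1 := (Nat.ceil_lt_add_one (by positivity)).le
  calc (⌈C / w⌉₊ : ℝ) * w ≤ (C / w + 1) * w := by gcongr
    _ = C + w := by field_simp

end Bath

/-! ### Realizing a coupling by a conserving permutation. -/

section Transport

variable {X Y : Type} [Fintype X] [DecidableEq X] [Fintype Y] [DecidableEq Y]

/-- Numerical estimate: a large reservoir makes rounding and boundary effects negligible. -/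
theorem sub_le_div_of_large {v η θ N D B₁ B₂ Z : ℝ} (hη : η ≤ v) (hη0 : 0 < η) (hv : v ≤ 1)
    (hθ : 1 - η / 2 ≤ θ) (hN : 0 ≤ N) (hB₂ : 0 ≤ B₂)
    (hlarge : D * B₁ + B₂ ≤ η / 2 * N) (hZ : 0 < Z) (hZN : Z ≤ N + B₂) :
    v - η ≤ (θ * N * v - D * B₁) / Z := by
  rw [le_div_iff₀ hZ]
  have hv0 : 0 ≤ v := hη0.le.trans hη
  have h1 : (v - η) * Z ≤ (v - η) * (N + B₂) := by
    apply mul_le_mul_of_nonneg_left hZN; linarith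
  have h2 : (1 - η / 2) * (N * v) ≤ θ * (N * v) :=
    mul_le_mul_of_nonneg_right hθ (mul_nonneg hN hv0)
  have h3 : η / 2 * (N * v) ≤ η / 2 * N := by
    apply mul_le_mul_of_nonneg_left _ (by linarith)
    exact mul_le_of_le_one_right hN hv
  have h4 : (v - η) * B₂ ≤ B₂ := mul_le_of_le_one_left hB₂ (by linarith)
  nlinarith

/-- Bernoulli's inequality for the fraction of interior points of a large box. -/
theorem exists_box_interior_fraction (d : ℕ) {η : ℝ} (hη : 0 < η) :
    ∃ L : ℕ, 0 < L ∧ (1 - η) * (L : ℝ) ^ d ≤ ((L - 1 : ℕ) : ℝ) ^ d := by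
  obtain ⟨L, hL⟩ := exists_nat_ge ((d : ℝ) / η)
  refine ⟨L + 1, Nat.succ_pos L, ?_⟩
  have hpos : (0 : ℝ) < (L : ℝ) + 1 := by positivity
  have hb := one_add_mul_le_pow (a := -1 / ((L : ℝ) + 1)) (by
    rw [le_div_iff₀ hpos]
    have : (0 : ℝ) ≤ L := Nat.cast_nonneg L
    linarith) d
  have h1 : 1 + -1 / ((L : ℝ) + 1) = L / ((L : ℝ) + 1) := by field_simp; ring
  rw [h1, div_pow, le_div_iff₀ (by positivity)] at hb
  refine le_trans ?_ (by simpa using hb)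
  push_cast
  apply mul_le_mul_of_nonneg_right _ (by positivity)
  have h2 : (d : ℝ) / ((L : ℝ) + 1) ≤ η := by
    rw [div_le_iff₀ hpos]
    rw [div_le_iff₀ hη] at hL
    nlinarith
  have h3 : (d : ℝ) * (-1 / ((L : ℝ) + 1)) = -(d / ((L : ℝ) + 1)) := by ring
  rw [h3]
  linarith

/-- The counting core: with the help of a large reservoir, an energy-conserving permutation moves
a fraction at least `≈ π x y` of the equilibrium weight of `x` to the final level `y`, for any
coupling `π` of the equilibrium distributions. -/
theorem exists_reservoir_perm [Nonempty X] [Nonempty Y] (β μ : ℝ) (eX nX : X → ℝ) (eY nY : Y → ℝ)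
    {r : X → ℝ} (hr0 : ∀ x, 0 ≤ r x) (hr1 : ∑ x, r x = 1) {π : X → Y → ℝ} (hπ0 : ∀ x y, 0 ≤ π x y)
    (hrow : ∀ x, ∑ y, π x y = gibbs β μ eX nX x) (hcol : ∀ y, ∑ x, π x y = gibbs β μ eY nY y)
    {η : ℝ} (hη : 0 < η) :
    ∃ (L : ℕ) (C : ℝ), 0 < L ∧ 0 < C ∧
      ∃ φ : Equiv.Perm ((X × Y) × Reservoir β μ (fun z : X × Y => eX z.1 + eY z.2)
          (fun z => nX z.1 + nY z.2) L C),
        (∀ s, sector (φ s) = sector s) ∧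
        ∀ y, ∑ x, π x y * r x / gibbs β μ eX nX x - η ≤
          ∑ s, if (φ s).1.2 = y then r s.1.1 * (gibbs β μ eY nY s.1.2 *
            gibbs β μ (reservoirValue fun z : X × Y => eX z.1 + eY z.2)
              (reservoirValue fun z => nX z.1 + nY z.2) s.2) else 0 := by
  set e : X × Y → ℝ := fun z => eX z.1 + eY z.2 with he
  set n : X × Y → ℝ := fun z => nX z.1 + nY z.2 with hn
  set w : (X × Y → ℕ) → ℝ := boltzFactor β μ (occValue e) (occValue n) with hw
  have hw0 : ∀ t, 0 < w t := fun t => boltzFactor_pos _ _ _ _ t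
  set bX := boltzFactor β μ eX nX with hbX
  set bY := boltzFactor β μ eY nY with hbY
  have hbX0 : ∀ x, 0 < bX x := boltzFactor_pos _ _ _ _
  have hb : ∀ z, boltzFactor β μ e n z = bX z.1 * bY z.2 := boltzFactor_add β μ eX nX eY nY
  set ZX := partFun β μ eX nX with hZX
  set ZY := partFun β μ eY nY with hZY
  have hZX0 : 0 < ZX := partFun_pos _ _ _ _
  have hZY0 : 0 < ZY := partFun_pos _ _ _ _
  -- `v` is the image of `r` under the stochastic map obtained by conditioning `π` on `x`.
  set v : Y → ℝ := fun y => ∑ x, π x y * r x / gibbs β μ eX nX x with hv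
  have hg0 : ∀ x, 0 < gibbs β μ eX nX x := gibbs_pos _ _ _ _
  have hv1 : ∀ y, v y ≤ 1 := by
    intro y
    rw [← hr1]
    refine Finset.sum_le_sum fun x _ => ?_
    rw [div_le_iff₀ (hg0 x), mul_comm (r x), ← hrow x]
    exact mul_le_mul_of_nonneg_right
      (Finset.single_le_sum (fun y _ => hπ0 x y) (Finset.mem_univ y)) (hr0 x)
  obtain ⟨L, hL, hLfrac⟩ := exists_box_interior_fraction (Fintype.card (X × Y)) (half_pos hη)
  set inner : Finset (X × Y → ℕ) := Fintype.piFinset fun _ => Finset.Ico 1 L with hinner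
  have hinner_card : (inner.card : ℝ) = ((L - 1 : ℕ) : ℝ) ^ Fintype.card (X × Y) := by
    rw [hinner, Fintype.card_piFinset]
    simp
  set ρ : X → ℝ := fun x => r x / bX x with hρ
  have hρ0 : ∀ x, 0 ≤ ρ x := fun x => div_nonneg (hr0 x) (hbX0 x).le
  set D : ℝ := (∑ x, ρ x) / ZY with hD
  have hD0 : 0 ≤ D := div_nonneg (Finset.sum_nonneg fun x _ => hρ0 x) hZY0.le
  set B₁ : ℝ := ∑ t ∈ inner, w t with hB₁
  set B₂ : ℝ := ∑ k : X × Y → Fin L, w (fun z => (k z : ℕ)) with hB₂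
  have hB₁0 : 0 ≤ B₁ := Finset.sum_nonneg fun t _ => (hw0 t).le
  have hB₂0 : 0 ≤ B₂ := Finset.sum_nonneg fun t _ => (hw0 _).le
  -- `L` is fixed first and controls the boundary loss. Given `L`, the rounding losses `D * B₁`
  -- (floors of the counts) and `B₂` (ceilings of the degeneracies) are constants, so a large `C`
  -- makes them at most `η / 2` of the total; the `+ 1` keeps `C` positive.
  set C : ℝ := 2 / η * (D * B₁ + B₂) + 1 with hC
  have hC0 : 0 < C := by positivity
  refine ⟨L, C, hL, hC0, ?_⟩
  -- An interior sector `t` holds at least `C * bX x * bY y / w t` levels labelled `(x, y)`. The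
  -- table replaces the product `gX x * gY y` by `π x y`; equal marginals make row and column sums
  -- fit the class sizes. Boundary sectors are given no prescription.
  let c : (X × Y → ℕ) → X → Y → ℕ :=
    fun t x y => if t ∈ inner then ⌊C * (ZX * ZY * π x y) / w t⌋₊ else 0
  have hfloor : ∀ t x y, (⌊C * (ZX * ZY * π x y) / w t⌋₊ : ℝ) ≤ C * (ZX * ZY * π x y) / w t :=
    fun t x y => Nat.floor_le (div_nonneg (mul_nonneg hC0.le
      (mul_nonneg (mul_nonneg hZX0.le hZY0.le) (hπ0 x y))) (hw0 t).le)
  have hcell : ∀ t ∈ inner, ∀ z, C * (bX z.1 * bY z.2) / w t ≤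
      ((Finset.univ.filter fun s : (X × Y) × Reservoir β μ e n L C =>
        sector s = t ∧ s.1 = z).card : ℝ) := by
    intro t ht z
    rw [← hb]
    exact le_card_sector β μ e n L C t (Fintype.mem_piFinset.mp ht) z
  have hZXg : ∀ x, ZX * gibbs β μ eX nX x = bX x := fun x => mul_div_cancel₀ _ hZX0.ne'
  have hZYg : ∀ y, ZY * gibbs β μ eY nY y = bY y := fun y => mul_div_cancel₀ _ hZY0.ne'
  have hrowc : ∀ t x, ∑ y, c t x y ≤ (Finset.univ.filter
      fun s : (X × Y) × Reservoir β μ e n L C => sector s = t ∧ s.1.1 = x).card := by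
    intro t x
    by_cases ht : t ∈ inner
    · have h1 : (Finset.univ.filter
          fun s : (X × Y) × Reservoir β μ e n L C => sector s = t ∧ s.1.1 = x).card =
          ∑ y, (Finset.univ.filter
            fun s : (X × Y) × Reservoir β μ e n L C => sector s = t ∧ s.1 = (x, y)).card := by
        rw [Finset.card_eq_sum_card_fiberwise (f := fun s => s.1.2) (t := Finset.univ)
          (fun _ _ => Finset.mem_coe.mpr (Finset.mem_univ _))]
        refine Finset.sum_congr rfl fun y _ => ?_
        rw [Finset.filter_filter]
        simp only [Prod.ext_iff, and_assoc]
      rw [h1, ← Nat.cast_le (α := ℝ), Nat.cast_sum, Nat.cast_sum]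
      simp only [c, ht, if_true]
      calc ∑ y, (⌊C * (ZX * ZY * π x y) / w t⌋₊ : ℝ)
          ≤ ∑ y, C * (ZX * ZY * π x y) / w t := Finset.sum_le_sum fun y _ => hfloor t x y
        _ = ∑ y, C * (bX x * bY y) / w t := by
          rw [← Finset.sum_div, ← Finset.sum_div, ← Finset.mul_sum, ← Finset.mul_sum,
            ← Finset.mul_sum, ← Finset.mul_sum, hrow, mul_right_comm, hZXg]
          rfl
        _ ≤ _ := Finset.sum_le_sum fun y _ => hcell t ht (x, y)
    · simp [c, ht]
  have hcolc : ∀ t y, ∑ x, c t x y ≤ (Finset.univ.filter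
      fun s : (X × Y) × Reservoir β μ e n L C => sector s = t ∧ s.1.2 = y).card := by
    intro t y
    by_cases ht : t ∈ inner
    · have h1 : (Finset.univ.filter
          fun s : (X × Y) × Reservoir β μ e n L C => sector s = t ∧ s.1.2 = y).card =
          ∑ x, (Finset.univ.filter
            fun s : (X × Y) × Reservoir β μ e n L C => sector s = t ∧ s.1 = (x, y)).card := by
        rw [Finset.card_eq_sum_card_fiberwise (f := fun s => s.1.1) (t := Finset.univ)
          (fun _ _ => Finset.mem_coe.mpr (Finset.mem_univ _))]
        refine Finset.sum_congr rfl fun x _ => ?_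
        rw [Finset.filter_filter]
        simp only [Prod.ext_iff, and_assoc, and_comm]
      rw [h1, ← Nat.cast_le (α := ℝ), Nat.cast_sum, Nat.cast_sum]
      simp only [c, ht, if_true]
      calc ∑ x, (⌊C * (ZX * ZY * π x y) / w t⌋₊ : ℝ)
          ≤ ∑ x, C * (ZX * ZY * π x y) / w t := Finset.sum_le_sum fun x _ => hfloor t x y
        _ = ∑ x, C * (bX x * bY y) / w t := by
          rw [← Finset.sum_div, ← Finset.sum_div, ← Finset.mul_sum, ← Finset.mul_sum,
            ← Finset.mul_sum, ← Finset.sum_mul, hcol, mul_assoc ZX, hZYg]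
          rfl
        _ ≤ _ := Finset.sum_le_sum fun x _ => hcell t ht (x, y)
    · simp [c, ht]
  obtain ⟨φ, hφsec, hφ⟩ := exists_perm_of_sector_counts
    (sector : (X × Y) × Reservoir β μ e n L C → X × Y → ℕ) (fun s => s.1.1) (fun s => s.1.2) c
    hrowc hcolc
  refine ⟨φ, hφsec, fun y => ?_⟩
  have : Nonempty (Reservoir β μ e n L C) :=
    ⟨⟨fun _ => ⟨0, hL⟩, ⟨0, Nat.ceil_pos.mpr (div_pos hC0 (boltzFactor_pos _ _ _ _ _))⟩⟩⟩
  set ZG := partFun β μ (reservoirValue e) (reservoirValue n : Reservoir β μ e n L C → ℝ) with hZG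
  have hZG0 : 0 < ZG := partFun_pos _ _ _ _
  -- The initial probability of a level depends only on its `x` and its sector, so the transported
  -- probability can be estimated from counts alone.
  have hterm : ∀ s : (X × Y) × Reservoir β μ e n L C,
      r s.1.1 * (gibbs β μ eY nY s.1.2 * gibbs β μ (reservoirValue e) (reservoirValue n) s.2) =
        ρ s.1.1 * w (sector s) / (ZY * ZG) := by
    intro s
    rw [hw, boltzFactor_sector, hb, hρ]
    have := (hbX0 s.1.1).ne'
    unfold gibbs
    rw [← hbY, ← hZY, ← hZG]
    field_simp
  simp only [hterm]
  have hterm0 : ∀ s : (X × Y) × Reservoir β μ e n L C,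
      0 ≤ ρ s.1.1 * w (sector s) / (ZY * ZG) := fun s =>
    div_nonneg (mul_nonneg (hρ0 _) (hw0 _).le) (mul_pos hZY0 hZG0).le
  -- If `v y < η`, the claimed lower bound is negative; the numerical estimate needs `η ≤ v y`.
  rcases le_or_gt η (v y) with hvy | hvy
  swap
  · refine le_trans (sub_nonpos.mpr hvy.le) (Finset.sum_nonneg fun s _ => ?_)
    split_ifs
    exacts [hterm0 s, le_rfl]
  rw [← Finset.sum_filter]
  have hfib : ∑ p ∈ inner ×ˢ (Finset.univ : Finset X),
      (c p.1 p.2 y : ℝ) * (ρ p.2 * w p.1 / (ZY * ZG)) ≤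
      ∑ s ∈ Finset.univ.filter fun s => (φ s).1.2 = y, ρ s.1.1 * w (sector s) / (ZY * ZG) := by
    calc ∑ p ∈ inner ×ˢ (Finset.univ : Finset X), (c p.1 p.2 y : ℝ) * (ρ p.2 * w p.1 / (ZY * ZG))
        ≤ ∑ p ∈ inner ×ˢ (Finset.univ : Finset X),
          ∑ s ∈ Finset.univ.filter (fun s => (φ s).1.2 = y) with (sector s, s.1.1) = p,
            ρ s.1.1 * w (sector s) / (ZY * ZG) := by
          refine Finset.sum_le_sum fun p _ => ?_
          have h1 : ∀ s ∈ (Finset.univ.filter (fun s => (φ s).1.2 = y)).filter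
              (fun s => (sector s, s.1.1) = p), ρ s.1.1 * w (sector s) / (ZY * ZG) =
                ρ p.2 * w p.1 / (ZY * ZG) := by
            intro s hs
            rw [← (Finset.mem_filter.mp hs).2]
          rw [Finset.sum_congr rfl h1, Finset.sum_const, nsmul_eq_mul]
          refine mul_le_mul_of_nonneg_right ?_
            (div_nonneg (mul_nonneg (hρ0 _) (hw0 _).le) (mul_pos hZY0 hZG0).le)
          refine Nat.cast_le.mpr ((hφ p.1 p.2 y).trans (Finset.card_le_card fun s hs => ?_))
          simp only [Finset.mem_filter, Finset.mem_univ, true_and] at hs ⊢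
          exact ⟨hs.2.2, Prod.ext hs.1 hs.2.1⟩
      _ ≤ _ := Finset.sum_fiberwise_le_sum_of_sum_fiber_nonneg fun p _ =>
          Finset.sum_nonneg fun s _ => hterm0 s
  refine le_trans ?_ hfib
  have hlow : ∑ p ∈ inner ×ˢ (Finset.univ : Finset X),
      (C * (ZX * ZY * π p.2 y) / w p.1 - 1) * (ρ p.2 * w p.1 / (ZY * ZG)) ≤
      ∑ p ∈ inner ×ˢ (Finset.univ : Finset X),
        (c p.1 p.2 y : ℝ) * (ρ p.2 * w p.1 / (ZY * ZG)) := by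
    refine Finset.sum_le_sum fun p hp => mul_le_mul_of_nonneg_right ?_
      (div_nonneg (mul_nonneg (hρ0 _) (hw0 _).le) (mul_pos hZY0 hZG0).le)
    have hp1 : p.1 ∈ inner := (Finset.mem_product.mp hp).1
    simp only [c, hp1, if_true]
    have := Nat.lt_floor_add_one (C * (ZX * ZY * π p.2 y) / w p.1)
    linarith
  refine le_trans ?_ hlow
  -- The weight `w t` cancels against the `1 / w t` in the counts, so every interior sector
  -- contributes the same main term; the `- 1` from the floor adds up to `D * B₁`.
  have heval : ∑ p ∈ inner ×ˢ (Finset.univ : Finset X),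
      (C * (ZX * ZY * π p.2 y) / w p.1 - 1) * (ρ p.2 * w p.1 / (ZY * ZG)) =
      (inner.card * C * v y - D * B₁) / ZG := by
    have h1 : ∀ (t : X × Y → ℕ) (x : X),
        (C * (ZX * ZY * π x y) / w t - 1) * (ρ x * w t / (ZY * ZG)) =
        C / ZG * (π x y * r x / gibbs β μ eX nX x) - w t * (ρ x / (ZY * ZG)) := by
      intro t x
      have h2 := (hw0 t).ne'
      have h3 := (hbX0 x).ne'
      simp only [hρ, gibbs]
      rw [← hbX, ← hZX]
      field_simp
    rw [Finset.sum_product]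
    simp only [h1, Finset.sum_sub_distrib, ← Finset.mul_sum, Finset.sum_const, nsmul_eq_mul,
      ← Finset.sum_mul, ← Finset.sum_div]
    have h2 : ∑ x, π x y * r x / gibbs β μ eX nX x = v y := rfl
    rw [h2, ← hB₁, hD]
    field_simp
  rw [heval]
  set N : ℝ := (L : ℝ) ^ Fintype.card (X × Y) * C with hN
  have hLd : (1 : ℝ) ≤ (L : ℝ) ^ Fintype.card (X × Y) := one_le_pow₀ (by exact_mod_cast hL)
  have hNC : C ≤ N := le_mul_of_one_le_left hC0.le hLd
  have hθ : (inner.card : ℝ) * C * v y =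
      (inner.card / (L : ℝ) ^ Fintype.card (X × Y)) * N * v y := by
    rw [hN]
    field_simp
  rw [hθ]
  refine sub_le_div_of_large hvy hη (hv1 y) ?_ (hC0.le.trans hNC) hB₂0 ?_ hZG0
    (partFun_reservoir_le β μ e n L C hC0.le)
  · rw [le_div_iff₀ (by linarith), hinner_card]
    exact hLfrac
  · have h1 : η / 2 * C = (D * B₁ + B₂) + η / 2 := by rw [hC]; field_simp
    have h2 : η / 2 * C ≤ η / 2 * N := mul_le_mul_of_nonneg_left hNC (half_pos hη).le
    linarith

end Transport

/-! ### Sufficient conditions: couplings and subcouplings of equilibrium distributions. -/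

section Sufficiency

variable {ι κ α : Type} [Fintype ι] [DecidableEq ι] [Fintype κ] [DecidableEq κ]
  [Fintype α] [DecidableEq α]

omit [DecidableEq ι] [DecidableEq κ] in
theorem gibbs_comp_equiv (β μ : ℝ) (e n : ι → ℝ) (f : κ ≃ ι) (k : κ) :
    gibbs β μ (fun k => e (f k)) (fun k => n (f k)) k = gibbs β μ e n (f k) := by
  unfold gibbs partFun
  rw [← Equiv.sum_comp f]
  rfl

/-- A coupling of the equilibrium distributions is realized, to any precision, by an
energy- and number-conserving bijection that involves a finite bath. -/
theorem exists_bath_equiv [Nonempty ι] [Nonempty κ] (β μ : ℝ) (e n : ι → ℝ) (e' n' : κ → ℝ)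
    {r : ι → ℝ} (hr0 : ∀ x, 0 ≤ r x) (hr1 : ∑ x, r x = 1) {π : ι → κ → ℝ} (hπ0 : ∀ x y, 0 ≤ π x y)
    (hrow : ∀ x, ∑ y, π x y = gibbs β μ e n x) (hcol : ∀ y, ∑ x, π x y = gibbs β μ e' n' y)
    {η : ℝ} (hη : 0 < η) :
    ∃ (k m : ℕ) (eG nG : Fin (k + 1) → ℝ) (eA nA : Fin m → ℝ)
      (f : ι × Fin (k + 1) ≃ κ × Fin m),
      (∀ p, e' (f p).1 + eA (f p).2 = e p.1 + eG p.2) ∧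
      (∀ p, n' (f p).1 + nA (f p).2 = n p.1 + nG p.2) ∧
      ∀ y, ∑ x, π x y * r x / gibbs β μ e n x - η ≤
        ∑ p, if (f p).1 = y then r p.1 * gibbs β μ eG nG p.2 else 0 := by
  obtain ⟨L, C, hL, hC, φ, hsec, hφ⟩ :=
    exists_reservoir_perm β μ e n e' n' hr0 hr1 hπ0 hrow hcol hη
  let eT : ι × κ → ℝ := fun z => e z.1 + e' z.2
  let nT : ι × κ → ℝ := fun z => n z.1 + n' z.2
  let Res := Reservoir β μ eT nT L C
  have hRes : Nonempty Res :=
    ⟨⟨fun _ => ⟨0, hL⟩, ⟨0, Nat.ceil_pos.mpr (div_pos hC (boltzFactor_pos _ _ _ _ _))⟩⟩⟩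
  obtain ⟨k, hk⟩ := Nat.exists_eq_succ_of_ne_zero (Fintype.card_ne_zero (α := κ × Res))
  -- The bath is an equilibrium copy of the target system together with the reservoir. Afterwards
  -- that copy is kept as the output, and the original system is discarded with the reservoir.
  let eqG : Fin (k + 1) ≃ κ × Res := (Fintype.equivFinOfCardEq hk).symm
  let eqA : Fin (Fintype.card (ι × Res)) ≃ ι × Res := (Fintype.equivFin _).symm
  let g : ι × Fin (k + 1) ≃ (ι × κ) × Res :=
    ((Equiv.refl ι).prodCongr eqG).trans (Equiv.prodAssoc ι κ Res).symm
  let f : ι × Fin (k + 1) ≃ κ × Fin (Fintype.card (ι × Res)) :=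
    ((g.trans φ).trans (((Equiv.prodComm ι κ).prodCongr (Equiv.refl Res)).trans
      (Equiv.prodAssoc κ ι Res))).trans ((Equiv.refl κ).prodCongr eqA.symm)
  have hf : ∀ p, f p = ((φ (g p)).1.2, eqA.symm ((φ (g p)).1.1, (φ (g p)).2)) := fun p => rfl
  have hg : ∀ p, g p = ((p.1, (eqG p.2).1), (eqG p.2).2) := fun p => rfl
  have hval : ∀ (u : ι × κ → ℝ) (s : (ι × κ) × Res),
      u (φ s).1 + reservoirValue u (φ s).2 = u s.1 + reservoirValue u s.2 := fun u s => by
    rw [← occValue_sector, ← occValue_sector]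
    exact congrArg (occValue u) (hsec s)
  refine ⟨k, _, fun j => e' (eqG j).1 + reservoirValue eT (eqG j).2,
    fun j => n' (eqG j).1 + reservoirValue nT (eqG j).2,
    fun j => e (eqA j).1 + reservoirValue eT (eqA j).2,
    fun j => n (eqA j).1 + reservoirValue nT (eqA j).2, f, fun p => ?_, fun p => ?_, fun y => ?_⟩
  · have h := hval eT (g p)
    simp only [hf, Equiv.apply_symm_apply]
    simp only [eT, hg] at h ⊢
    linarith
  · have h := hval nT (g p)
    simp only [hf, Equiv.apply_symm_apply]
    simp only [nT, hg] at h ⊢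
    linarith
  · refine (hφ y).trans (le_of_eq ?_)
    rw [← Equiv.sum_comp g]
    refine Finset.sum_congr rfl fun p _ => ?_
    rw [gibbs_comp_equiv β μ (fun z : κ × Res => e' z.1 + reservoirValue eT z.2)
      (fun z => n' z.1 + reservoirValue nT z.2), gibbs_add]
    rfl

omit [DecidableEq κ] in
theorem partialTrace_mul_mul (M N : Matrix κ κ ℂ) (X : Matrix (κ × α) (κ × α) ℂ) :
    partialTrace ((M ⊗ₖ (1 : Matrix α α ℂ)) * X * (N ⊗ₖ (1 : Matrix α α ℂ))) =
      M * partialTrace X * N := by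
  ext i j
  simp only [partialTrace, Matrix.of_apply, Matrix.mul_apply, Fintype.sum_prod_type,
    Matrix.kroneckerMap_apply, Matrix.one_apply, mul_ite, mul_one, mul_zero, ite_mul, zero_mul,
    Finset.sum_ite_eq, Finset.sum_ite_eq', Finset.mem_univ, if_true, Finset.mul_sum,
    Finset.sum_mul]
  rw [Finset.sum_comm]
  refine Finset.sum_congr rfl fun l _ => ?_
  rw [Finset.sum_comm]

omit [Fintype κ] in
theorem partialTrace_realDiag (d : κ × α → ℝ) :
    partialTrace (realDiag d) = realDiag (fun y => ∑ a, d (y, a)) := by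
  ext i j
  by_cases h : i = j
  · subst h
    simp [partialTrace, realDiag]
  · simp [partialTrace, realDiag, h]

theorem partialTrace_inFrame (W : Matrix κ κ ℂ) (d : κ × α → ℝ) :
    partialTrace (inFrame (W ⊗ₖ (1 : Matrix α α ℂ)) d) = inFrame W (fun y => ∑ a, d (y, a)) := by
  rw [inFrame, Matrix.conjTranspose_kronecker, Matrix.conjTranspose_one, partialTrace_mul_mul,
    partialTrace_realDiag, inFrame]

/-- The permutation matrix of a bijection. -/
def permMat (f : ι ≃ κ) : Matrix κ ι ℂ := (1 : Matrix ι ι ℂ).submatrix f.symm id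

omit [Fintype κ] in
theorem permMat_mul_realDiag (f : ι ≃ κ) (d : ι → ℝ) :
    permMat f * realDiag d * (permMat f)ᴴ = realDiag (fun k => d (f.symm k)) := by
  ext i j
  simp [permMat, realDiag, Matrix.mul_apply, Matrix.diagonal_apply, Matrix.one_apply]
  split_ifs with h
  exacts [by rw [h], rfl]

theorem isUnitaryMat_permMat (f : ι ≃ κ) : IsUnitaryMat (permMat f) := by
  constructor
  · have h := permMat_mul_realDiag f (fun _ => 1)
    rwa [realDiag_one, realDiag_one, Matrix.mul_one] at h
  · ext i j
    simp [permMat, Matrix.mul_apply, Matrix.one_apply]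
    rw [← Equiv.sum_comp f]
    simp [eq_comm]

/-- The system with given energies and particle numbers of the basis states. -/
def diagSystem (e n : ι → ℝ) : GPSystem ι where
  H := realDiag e
  N := realDiag n
  isHermitian_H := by simpa [inFrame] using isHermitian_inFrame 1 e
  isHermitian_N := by simpa [inFrame] using isHermitian_inFrame 1 n
  commute_HN := Matrix.commute_diagonal _ _

theorem diagSystem_frame (e n : ι → ℝ) : SysFrame (diagSystem e n) 1 e n where
  unitary := isUnitaryMat_one
  H_eq := by simp [inFrame, diagSystem]
  N_eq := by simp [inFrame, diagSystem]

/-- A conserving bijection of the levels of `R` and a bath with those of the target system and a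
discarded system gives an equilibrating operation. -/
theorem isEquilibratingOutput_of_equiv {β μ : ℝ} {R : GPState ι} {S : GPSystem κ}
    {W : Matrix ι ι ℂ} {r e n : ι → ℝ} (hR : StateFrame R W r e n)
    {W' : Matrix κ κ ℂ} {e' n' : κ → ℝ} (hS : SysFrame S W' e' n') {k m : ℕ}
    {eG nG : Fin (k + 1) → ℝ} {eA nA : Fin m → ℝ} (f : ι × Fin (k + 1) ≃ κ × Fin m)
    (hfe : ∀ p, e' (f p).1 + eA (f p).2 = e p.1 + eG p.2)
    (hfn : ∀ p, n' (f p).1 + nA (f p).2 = n p.1 + nG p.2) :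
    IsEquilibratingOutput β μ R S
      (inFrame W' fun y => ∑ p, if (f p).1 = y then r p.1 * gibbs β μ eG nG p.2 else 0) := by
  have hG := diagSystem_frame eG nG
  have hA := diagSystem_frame eA nA
  have hRG := hR.toSysFrame.add hG
  have hSA := hS.add hA
  set WR := W ⊗ₖ (1 : Matrix (Fin (k + 1)) (Fin (k + 1)) ℂ) with hWR
  set WS := W' ⊗ₖ (1 : Matrix (Fin m) (Fin m) ℂ) with hWS
  set V := WS * permMat f * WRᴴ with hV
  have hVunit : IsUnitaryMat V :=
    (hSA.unitary.mul (isUnitaryMat_permMat f)).mul hRG.unitary.conjTranspose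
  have hconj : ∀ d, V * inFrame WR d * Vᴴ = inFrame WS (fun q => d (f.symm q)) := by
    intro d
    have h1 : V * inFrame WR d * Vᴴ =
        WS * (permMat f * (WRᴴ * WR) * realDiag d * (WRᴴ * WR) * (permMat f)ᴴ) * WSᴴ := by
      rw [hV]
      simp only [inFrame, Matrix.conjTranspose_mul, Matrix.conjTranspose_conjTranspose,
        Matrix.mul_assoc]
    rw [h1, hRG.unitary.2, Matrix.mul_one, Matrix.mul_one, permMat_mul_realDiag, inFrame]
  -- The whole dynamics is placed in the identification `V`, which may be any unitary that matches
  -- the total Hamiltonian and number operator, so `U = 1`.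
  refine ⟨k, m, diagSystem eG nG, diagSystem eA nA, 1, V, ⟨by simp, by simp, Commute.one_left _,
    Commute.one_left _⟩, ⟨hVunit.1, hVunit.2, ?_, ?_⟩, ?_⟩
  · have h1 : (R.add (freeState β μ (diagSystem eG nG))).H =
        (R.toGPSystem.add (diagSystem eG nG)).H := rfl
    rw [h1, hRG.H_eq, hconj, hSA.H_eq]
    congr 1
    ext q
    have := hfe (f.symm q)
    rw [Equiv.apply_symm_apply] at this
    exact this.symm
  · have h1 : (R.add (freeState β μ (diagSystem eG nG))).N =
        (R.toGPSystem.add (diagSystem eG nG)).N := rfl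
    rw [h1, hRG.N_eq, hconj, hSA.N_eq]
    congr 1
    ext q
    have := hfn (f.symm q)
    rw [Equiv.apply_symm_apply] at this
    exact this.symm
  · have hρ : (R.add (freeState β μ (diagSystem eG nG))).ρ =
        inFrame WR (fun p => r p.1 * gibbs β μ eG nG p.2) := by
      rw [hWR, ← inFrame_kronecker, ← hR.ρ_eq, ← freeState_eq_inFrame β μ hG]
      rfl
    rw [Matrix.conjTranspose_one, Matrix.one_mul, Matrix.mul_one, hρ, hconj, hWS,
      partialTrace_inFrame]
    congr 1
    ext y
    rw [← Equiv.sum_comp f.symm]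
    simp only [Equiv.apply_symm_apply]
    rw [Fintype.sum_prod_type, Finset.sum_eq_single y]
    · simp
    · intro y' _ hy'
      simp [hy']
    · simp

/-- The trace distance of commuting states in terms of their overlap. -/
theorem traceDist_inFrame {W : Matrix ι ι ℂ} (hW : IsUnitaryMat W) {p q : ι → ℝ}
    (hp : ∑ i, p i = 1) (hq : ∑ i, q i = 1) :
    traceDist (inFrame W p) (inFrame W q) = 1 - ∑ i, min (p i) (q i) := by
  rw [traceDist, inFrame_sub, traceNorm_inFrame hW]
  have h : ∀ i, |p i - q i| = p i + q i - 2 * min (p i) (q i) := by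
    intro i
    rcases le_total (p i) (q i) with h | h
    · rw [min_eq_left h, abs_of_nonpos (by linarith)]; ring
    · rw [min_eq_right h, abs_of_nonneg (by linarith)]; ring
  simp only [h, Finset.sum_sub_distrib, Finset.sum_add_distrib, hp, hq, ← Finset.mul_sum]
  ring

/-- A density operator that is diagonal in the eigenbasis of a system makes it a state. -/
def stateOfFrame (S : GPSystem κ) {W : Matrix κ κ ℂ} {e n : κ → ℝ} (hS : SysFrame S W e n)
    (v : κ → ℝ) (hv0 : ∀ y, 0 ≤ v y) (hv1 : ∑ y, v y = 1) : GPState κ where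
  toGPSystem := S
  ρ := inFrame W v
  posSemidef_ρ := posSemidef_inFrame W hv0
  trace_ρ := by rw [trace_inFrame hS.unitary, hv1, Complex.ofReal_one]
  commute_ρH := by
    rw [hS.H_eq, Commute, SemiconjBy, inFrame_mul hS.unitary, inFrame_mul hS.unitary]
    simp only [mul_comm]
  commute_ρN := by
    rw [hS.N_eq, Commute, SemiconjBy, inFrame_mul hS.unitary, inFrame_mul hS.unitary]
    simp only [mul_comm]

/-- The output of the stochastic map given by a coupling of the equilibrium distributions can be
reached. -/
theorem reaches_of_coupling [Nonempty ι] [Nonempty κ] {β μ : ℝ} {R : GPState ι} {S : GPState κ}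
    {W : Matrix ι ι ℂ} {r e n : ι → ℝ} (hR : StateFrame R W r e n)
    {W' : Matrix κ κ ℂ} {v e' n' : κ → ℝ} (hS : StateFrame S W' v e' n') {π : ι → κ → ℝ}
    (hπ0 : ∀ x y, 0 ≤ π x y) (hrow : ∀ x, ∑ y, π x y = gibbs β μ e n x)
    (hcol : ∀ y, ∑ x, π x y = gibbs β μ e' n' y)
    (hv : ∀ y, v y = ∑ x, π x y * r x / gibbs β μ e n x) : Reaches β μ R S := by
  intro η hη
  have hcard : (0 : ℝ) < Fintype.card κ := by exact_mod_cast Fintype.card_pos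
  obtain ⟨k, m, eG, nG, eA, nA, f, hfe, hfn, hlow⟩ := exists_bath_equiv β μ e n e' n' hR.nonneg
    hR.sum_eq_one hπ0 hrow hcol (div_pos hη hcard)
  set s : κ → ℝ := fun y => ∑ p, if (f p).1 = y then r p.1 * gibbs β μ eG nG p.2 else 0 with hs
  have hs1 : ∑ y, s y = 1 := by
    rw [hs, Finset.sum_comm]
    simp only [Finset.sum_ite_eq, Finset.mem_univ, if_true, Fintype.sum_prod_type,
      ← Finset.mul_sum, sum_gibbs, mul_one, hR.sum_eq_one]
  refine ⟨inFrame W' s, isEquilibratingOutput_of_equiv hR hS.toSysFrame f hfe hfn, ?_⟩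
  rw [hS.ρ_eq, traceDist_inFrame hS.unitary hs1 hS.sum_eq_one]
  -- A one-sided bound on each component suffices: both vectors have mass one, so the overlap
  -- determines the distance.
  have h1 : ∑ y, (v y - η / Fintype.card κ) ≤ ∑ y, min (s y) (v y) := by
    refine Finset.sum_le_sum fun y _ => le_min ?_ ?_
    · rw [hv]; exact hlow y
    · have := div_pos hη hcard
      linarith
  rw [Finset.sum_sub_distrib, hS.sum_eq_one, Finset.sum_const, Finset.card_univ, nsmul_eq_mul,
    mul_div_cancel₀ _ hcard.ne'] at h1
  linarith

omit [DecidableEq ι] [DecidableEq κ] in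
/-- A subcoupling of two distributions of equal mass extends to a coupling. -/
theorem exists_coupling_extending {a : ι → ℝ} {b : κ → ℝ} (hab : ∑ x, a x = ∑ y, b y)
    {π₀ : ι → κ → ℝ} (hrow : ∀ x, ∑ y, π₀ x y ≤ a x) (hcol : ∀ y, ∑ x, π₀ x y ≤ b y) :
    ∃ π : ι → κ → ℝ, (∀ x y, π₀ x y ≤ π x y) ∧ (∀ x, ∑ y, π x y = a x) ∧
      ∀ y, ∑ x, π x y = b y := by
  set a' : ι → ℝ := fun x => a x - ∑ y, π₀ x y with ha'
  set b' : κ → ℝ := fun y => b y - ∑ x, π₀ x y with hb'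
  have ha0 : ∀ x, 0 ≤ a' x := fun x => sub_nonneg.mpr (hrow x)
  have hb0 : ∀ y, 0 ≤ b' y := fun y => sub_nonneg.mpr (hcol y)
  set c := ∑ x, a' x with hc
  have hcb : ∑ y, b' y = c := by
    simp only [hc, ha', hb', Finset.sum_sub_distrib, hab]
    rw [Finset.sum_comm]
  have hc0 : 0 ≤ c := Finset.sum_nonneg fun x _ => ha0 x
  -- The residual masses `a'` and `b'` will be filled by the product `a' x * b' y / c`. If `c = 0`,
  -- the residuals vanish and division by zero gives the required zero.
  have hfa : ∀ x, a' x * c / c = a' x := by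
    intro x
    rcases hc0.eq_or_lt with h | h
    · have := (Finset.sum_eq_zero_iff_of_nonneg fun x _ => ha0 x).mp (hc.symm.trans h.symm) x
        (Finset.mem_univ x)
      rw [this]; simp
    · exact mul_div_cancel_right₀ _ h.ne'
  have hfb : ∀ y, c * b' y / c = b' y := by
    intro y
    rcases hc0.eq_or_lt with h | h
    · have := (Finset.sum_eq_zero_iff_of_nonneg fun y _ => hb0 y).mp (hcb.trans h.symm) y
        (Finset.mem_univ y)
      rw [this]; simp
    · exact mul_div_cancel_left₀ _ h.ne'
  refine ⟨fun x y => π₀ x y + a' x * b' y / c, fun x y => ?_, fun x => ?_, fun y => ?_⟩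
  · have := div_nonneg (mul_nonneg (ha0 x) (hb0 y)) hc0
    linarith
  · rw [Finset.sum_add_distrib, ← Finset.sum_div, ← Finset.mul_sum, hcb, hfa]
    simp [ha']
  · rw [Finset.sum_add_distrib, ← Finset.sum_div, ← Finset.sum_mul, ← hc, hfb]
    simp [hb']

/-- A partial stochastic map that respects the equilibrium distributions and yields at least the
fraction `1 - ε` of the target state suffices for an `ε`-approximate transformation. -/
theorem reachesApprox_of_subcoupling [Nonempty ι] [Nonempty κ] {β μ ε : ℝ} {R : GPState ι}
    {S : GPState κ} {W : Matrix ι ι ℂ} {r e n : ι → ℝ} (hR : StateFrame R W r e n)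
    {W' : Matrix κ κ ℂ} {s e' n' : κ → ℝ} (hS : StateFrame S W' s e' n') {π₀ : ι → κ → ℝ}
    (hπ0 : ∀ x y, 0 ≤ π₀ x y) (hrow : ∀ x, ∑ y, π₀ x y ≤ gibbs β μ e n x)
    (hcol : ∀ y, ∑ x, π₀ x y ≤ gibbs β μ e' n' y)
    (hle : ∀ y, ∑ x, π₀ x y * r x / gibbs β μ e n x ≤ s y)
    (hε : 1 - ε ≤ ∑ y, ∑ x, π₀ x y * r x / gibbs β μ e n x) : ReachesApprox β μ ε R S := by
  obtain ⟨π, hππ₀, hπrow, hπcol⟩ := exists_coupling_extending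
    ((sum_gibbs β μ e n).trans (sum_gibbs β μ e' n').symm) hrow hcol
  have hπ : ∀ x y, 0 ≤ π x y := fun x y => (hπ0 x y).trans (hππ₀ x y)
  have hg := gibbs_pos β μ e n
  set v : κ → ℝ := fun y => ∑ x, π x y * r x / gibbs β μ e n x with hv
  have hv0 : ∀ y, 0 ≤ v y := fun y => Finset.sum_nonneg fun x _ =>
    div_nonneg (mul_nonneg (hπ x y) (hR.nonneg x)) (hg x).le
  have hv1 : ∑ y, v y = 1 := by
    rw [hv, Finset.sum_comm, ← hR.sum_eq_one]
    refine Finset.sum_congr rfl fun x _ => ?_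
    rw [← Finset.sum_div, ← Finset.sum_mul, hπrow, mul_div_cancel_left₀ _ (hg x).ne']
  refine ⟨stateOfFrame S.toGPSystem hS.toSysFrame v hv0 hv1, ⟨rfl, ?_⟩,
    reaches_of_coupling hR ⟨hS.toSysFrame, rfl⟩ hπ hπrow hπcol fun y => rfl⟩
  have hρ : (stateOfFrame S.toGPSystem hS.toSysFrame v hv0 hv1).ρ = inFrame W' v := rfl
  rw [hρ, hS.ρ_eq, traceDist_inFrame hS.unitary hv1 hS.sum_eq_one]
  -- The partial output lies below both the full output, as `π` extends `π₀`, and the target; its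
  -- mass bounds their overlap.
  have h1 : ∑ y, ∑ x, π₀ x y * r x / gibbs β μ e n x ≤ ∑ y, min (v y) (s y) := by
    refine Finset.sum_le_sum fun y _ => le_min (Finset.sum_le_sum fun x _ => ?_) (hle y)
    exact div_le_div_of_nonneg_right (mul_le_mul_of_nonneg_right (hππ₀ x y) (hR.nonneg x)) (hg x).le
  linarith

end Sufficiency

/-! ### Criteria for work gain and work cost. -/

section WorkValue

variable {ι : Type} [Fintype ι] [DecidableEq ι]

/-- The equilibrium distribution of a battery. -/
def Battery.gibbs (β μ : ℝ) (B : Battery) : B.levels → ℝ :=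
  GrandPotential.gibbs β μ (fun e : B.levels => (e : ℝ)) (fun _ => B.number)

theorem Battery.gibbs_pos (β μ : ℝ) (B : Battery) (E : B.levels) : 0 < B.gibbs β μ E :=
  have : Nonempty B.levels := ⟨E⟩
  GrandPotential.gibbs_pos _ _ _ _ E

/-- The number operator is constant on a battery, so `μ` and the partition function cancel in the
ratio and only the level difference remains. -/
theorem Battery.gibbs_eq_exp_mul (β μ : ℝ) (B : Battery) (E F : B.levels) :
    B.gibbs β μ F = Real.exp (-(β * ((F : ℝ) - E))) * B.gibbs β μ E := by
  simp only [Battery.gibbs, GrandPotential.gibbs, boltzFactor]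
  rw [← mul_div_assoc, ← Real.exp_add]
  congr 2
  ring

/-- Work `F - E` can be extracted if and only if the optimal type II error is at most
`exp (-β (F - E))`. -/
theorem reachesApprox_gain_iff [Nonempty ι] {β μ ε : ℝ} {R : GPState ι} {W : Matrix ι ι ℂ}
    {r e n : ι → ℝ} (hR : StateFrame R W r e n) (hε : 0 ≤ ε) (B : Battery) (E F : B.levels) :
    ReachesApprox β μ ε (R.add (B.state E)) (B.state F) ↔
      typeIIError ε R.ρ (freeState β μ R.toGPSystem).ρ ≤ Real.exp (-(β * ((F : ℝ) - E))) := by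
  have : Nonempty B.levels := ⟨E⟩
  have hg := gibbs_pos β μ e n
  have hB := B.gibbs_pos β μ
  have hRB := hR.add (battery_frame B E)
  have hF := battery_frame B F
  rw [freeState_eq_inFrame β μ hR.toSysFrame, hR.ρ_eq,
    typeIIError_le_iff hR.unitary hR.sum_eq_one (fun i => (hg i).le) hε]
  constructor
  · intro h
    obtain ⟨q', hq', hqg, hqr⟩ := h.pullback hRB hF (q := Pi.single F 1) (fun y => by
      by_cases hy : y = F
      · subst hy; simp
      · simp [hy])
    refine ⟨fun i => q' (i, E), fun i => hq' _, ?_, ?_⟩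
    · simpa [Fintype.sum_prod_type, Pi.single_apply] using hqr
    -- Only the slice at battery level `E` carries input probability; dropping the other nonnegative
    -- terms turns the equilibrium balance into a bound.
    · have h1 : ∑ i, q' (i, E) * (gibbs β μ e n i * B.gibbs β μ E) ≤ B.gibbs β μ F := by
        have h2 : ∑ y, (Pi.single F 1 : B.levels → ℝ) y * gibbs β μ (fun e : B.levels => (e : ℝ))
            (fun _ => B.number) y = B.gibbs β μ F := by
          simp [Pi.single_apply, Battery.gibbs]
        rw [← h2, ← hqg, Fintype.sum_prod_type]
        refine Finset.sum_le_sum fun i _ => ?_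
        have h3 : ∀ b, q' (i, b) * gibbs β μ (fun p : ι × B.levels => e p.1 + (p.2 : ℝ))
            (fun p => n p.1 + B.number) (i, b) = q' (i, b) * (gibbs β μ e n i * B.gibbs β μ b) :=
          fun b => by rw [gibbs_add β μ e n (fun e : B.levels => (e : ℝ)) fun _ => B.number]; rfl
        simp only [h3]
        exact Finset.single_le_sum
          (f := fun b => q' (i, b) * (gibbs β μ e n i * B.gibbs β μ b))
          (fun b _ => mul_nonneg (hq' _).1 (mul_pos (hg i) (hB b)).le) (Finset.mem_univ E)
      rw [B.gibbs_eq_exp_mul β μ E F] at h1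
      simp only [← mul_assoc, ← Finset.sum_mul] at h1
      exact le_of_mul_le_mul_right h1 (hB E)
  · rintro ⟨q, hq, hqr, hqg⟩
    have hgB : ∀ p : ι × B.levels, gibbs β μ (fun p : ι × B.levels => e p.1 + (p.2 : ℝ))
        (fun p => n p.1 + B.number) p = gibbs β μ e n p.1 * B.gibbs β μ p.2 :=
      gibbs_add β μ e n (fun e : B.levels => (e : ℝ)) fun _ => B.number
    have hout : ∀ y, ∑ x : ι × B.levels,
        (if x.2 = E ∧ y = F then q x.1 * gibbs β μ e n x.1 * B.gibbs β μ E else 0) *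
          (r x.1 * (Pi.single E 1 : B.levels → ℝ) x.2) /
          gibbs β μ (fun p : ι × B.levels => e p.1 + (p.2 : ℝ)) (fun p => n p.1 + B.number) x =
        if y = F then ∑ i, q i * r i else 0 := by
      intro y
      by_cases hy : y = F
      · simp only [hy, and_true, if_true, hgB, Fintype.sum_prod_type]
        refine Finset.sum_congr rfl fun i _ => ?_
        rw [Finset.sum_eq_single E (fun b _ hb => by simp [hb]) (by simp)]
        have h1 := (hg i).ne'
        have h2 := (hB E).ne'
        simp only [if_true, Pi.single_eq_same, mul_one]
        field_simp
      · simp [hy]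
    -- The fraction `q i` of the equilibrium weight of `(i, E)` is sent to `F`; the type II bound
    -- says exactly that this fits into the weight of `F`.
    refine reachesApprox_of_subcoupling hRB hF
      (π₀ := fun x y => if x.2 = E ∧ y = F then q x.1 * gibbs β μ e n x.1 * B.gibbs β μ E else 0)
      ?_ ?_ ?_ ?_ ?_
    · intro x y
      split_ifs
      exacts [mul_nonneg (mul_nonneg (hq _).1 (hg _).le) (hB _).le, le_rfl]
    · intro x
      rw [hgB]
      by_cases hx : x.2 = E
      · simp only [hx, true_and, Finset.sum_ite_eq', Finset.mem_univ, if_true]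
        exact mul_le_mul_of_nonneg_right (mul_le_of_le_one_left (hg _).le (hq _).2) (hB _).le
      · simpa [hx] using (mul_pos (hg x.1) (hB x.2)).le
    · intro y
      by_cases hy : y = F
      · simp only [hy, and_true, Fintype.sum_prod_type, Finset.sum_ite_eq', Finset.mem_univ,
          if_true, ← Finset.sum_mul]
        change _ ≤ B.gibbs β μ F
        rw [B.gibbs_eq_exp_mul β μ E F]
        exact mul_le_mul_of_nonneg_right hqg (hB E).le
      · change _ ≤ B.gibbs β μ y
        simpa [hy] using (hB y).le
    · intro y
      rw [hout]
      by_cases hy : y = F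
      · subst hy
        simp only [if_true, Pi.single_eq_same]
        rw [← hR.sum_eq_one]
        exact Finset.sum_le_sum fun i _ => mul_le_of_le_one_left (hR.nonneg i) (hq i).2
      · simp [hy]
    · simpa only [hout, Finset.sum_ite_eq', Finset.mem_univ, if_true] using hqr

omit [DecidableEq ι] in
/-- Among all tests, the test for positivity maximizes a linear functional. -/
theorem sum_mul_le_sum_filter_pos {q x : ι → ℝ} (hq : ∀ i, q i ∈ Set.Icc (0 : ℝ) 1) :
    ∑ i, q i * x i ≤ ∑ i with 0 < x i, x i := by
  rw [Finset.sum_filter]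
  refine Finset.sum_le_sum fun i _ => ?_
  obtain ⟨h0, h1⟩ := hq i
  split_ifs with h <;> nlinarith

/-- Work `F - E` suffices to prepare the state if and only if the probability of each event,
reduced by `ε`, is at most `exp (β (F - E))` times its equilibrium probability. -/
theorem reachesApprox_cost_iff [Nonempty ι] {β μ ε : ℝ} {R : GPState ι} {W : Matrix ι ι ℂ}
    {r e n : ι → ℝ} (hR : StateFrame R W r e n) (B : Battery) (E F : B.levels) :
    ReachesApprox β μ ε (B.state F) (R.add (B.state E)) ↔
      ∀ A : Finset ι, ∑ i ∈ A, r i - ε ≤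
        Real.exp (β * ((F : ℝ) - E)) * ∑ i ∈ A, gibbs β μ e n i := by
  have : Nonempty B.levels := ⟨E⟩
  have hg := gibbs_pos β μ e n
  have hB := B.gibbs_pos β μ
  have hRB := hR.add (battery_frame B E)
  have hF := battery_frame B F
  have hgB : ∀ p : ι × B.levels, gibbs β μ (fun p : ι × B.levels => e p.1 + (p.2 : ℝ))
      (fun p => n p.1 + B.number) p = gibbs β μ e n p.1 * B.gibbs β μ p.2 :=
    gibbs_add β μ e n (fun e : B.levels => (e : ℝ)) fun _ => B.number
  set l := Real.exp (β * ((F : ℝ) - E)) with hl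
  have hl0 : 0 < l := Real.exp_pos _
  have hEF : B.gibbs β μ E = l * B.gibbs β μ F := by
    rw [B.gibbs_eq_exp_mul β μ F E, hl]
    congr 2
    ring
  constructor
  · intro h A
    obtain ⟨q', hq', hqg, hqr⟩ := h.pullback hF hRB
      (q := fun p => if p.1 ∈ A ∧ p.2 = E then 1 else 0) (fun y => by
        split_ifs <;> simp)
    have h1 : ∑ i ∈ A, r i - ε ≤ q' F := by
      refine le_trans (le_of_eq ?_) (hqr.trans (le_of_eq ?_))
      · rw [Fintype.sum_prod_type]
        simp [ite_and, Pi.single_apply, Finset.sum_ite_mem]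
      · simp [Pi.single_apply]
    have h2 : q' F * B.gibbs β μ F ≤ (∑ i ∈ A, gibbs β μ e n i) * B.gibbs β μ E := by
      have h3 := Finset.single_le_sum (f := fun b => q' b * B.gibbs β μ b)
        (fun b _ => mul_nonneg (hq' b).1 (hB b).le) (Finset.mem_univ F)
      refine h3.trans (hqg.le.trans (le_of_eq ?_))
      simp only [hgB, Fintype.sum_prod_type]
      simp [ite_and, Finset.sum_ite_mem, Finset.sum_mul]
    rw [hEF, ← mul_assoc] at h2
    have h3 := le_of_mul_le_mul_right h2 (hB F)
    linarith
  · intro h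
    -- The part of `r` that fits under the capacity `l * g`. Its deficit is the sum of `r - l * g`
    -- over the event where this is positive, so the hypothesis at that event bounds it by `ε`.
    set s : ι → ℝ := fun i => min (r i) (l * gibbs β μ e n i) with hs
    have hs0 : ∀ i, 0 ≤ s i := fun i => le_min (hR.nonneg i) (mul_pos hl0 (hg i)).le
    have hsum : 1 - ε ≤ ∑ i, s i := by
      have h1 := h (Finset.univ.filter fun i => 0 < r i - l * gibbs β μ e n i)
      have h2 : ∑ i, (r i - s i) =
          ∑ i with 0 < r i - l * gibbs β μ e n i, (r i - l * gibbs β μ e n i) := by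
        rw [Finset.sum_filter]
        refine Finset.sum_congr rfl fun i _ => ?_
        split_ifs with hi
        · rw [hs]; simp only [min_eq_right (sub_pos.mp hi).le]
        · rw [hs]; simp only [min_eq_left (sub_nonpos.mp (not_lt.mp hi)), sub_self]
      rw [Finset.sum_sub_distrib, hR.sum_eq_one, Finset.sum_sub_distrib, ← Finset.mul_sum] at h2
      linarith
    have hout : ∀ y : ι × B.levels, ∑ x : B.levels,
        (if x = F ∧ y.2 = E then B.gibbs β μ F * s y.1 else 0) *
          (Pi.single F 1 : B.levels → ℝ) x /
          gibbs β μ (fun e : B.levels => (e : ℝ)) (fun _ => B.number) x =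
        if y.2 = E then s y.1 else 0 := by
      intro y
      rw [Finset.sum_eq_single F (fun b _ hb => by simp [hb]) (by simp)]
      have h2 := (hB F).ne'
      change _ / B.gibbs β μ F = _
      by_cases hy : y.2 = E
      · simp only [hy, and_self, if_true, Pi.single_eq_same, mul_one]
        field_simp
      · simp [hy]
    refine reachesApprox_of_subcoupling hF hRB
      (π₀ := fun x y => if x = F ∧ y.2 = E then B.gibbs β μ F * s y.1 else 0) ?_ ?_ ?_ ?_ ?_
    · intro x y
      split_ifs
      exacts [mul_nonneg (hB _).le (hs0 _), le_rfl]
    · intro x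
      by_cases hx : x = F
      · subst hx
        simp only [true_and, Fintype.sum_prod_type, Finset.sum_ite_eq', Finset.mem_univ, if_true,
          ← Finset.mul_sum]
        refine mul_le_of_le_one_right (hB x).le ?_
        rw [← hR.sum_eq_one]
        exact Finset.sum_le_sum fun i _ => min_le_left _ _
      · change _ ≤ B.gibbs β μ x
        simpa [hx] using (hB x).le
    · intro y
      rw [hgB]
      by_cases hy : y.2 = E
      · simp only [hy, and_true, Finset.sum_ite_eq', Finset.mem_univ, if_true]
        rw [hEF]
        have := mul_le_mul_of_nonneg_left (min_le_right (r y.1) (l * gibbs β μ e n y.1)) (hB F).le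
        calc B.gibbs β μ F * s y.1 ≤ B.gibbs β μ F * (l * gibbs β μ e n y.1) := this
          _ = _ := by ring
      · simpa [hy] using (mul_pos (hg y.1) (hB y.2)).le
    · intro y
      rw [hout]
      by_cases hy : y.2 = E
      · simp only [hy, if_true, Pi.single_eq_same, mul_one]
        exact min_le_left _ _
      · simp [hy]
    · simpa only [hout, Fintype.sum_prod_type, Finset.sum_ite_eq', Finset.mem_univ, if_true]
        using hsum

/-- Batteries with arbitrary work difference, arbitrarily fine spacing and arbitrarily high levels
exist. -/
theorem exists_admissible_battery {β h : ℝ} (hβ : 0 < β) (hh : 0 < h) (c w : ℝ) :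
    ∃ (B : Battery) (E F : B.levels), (F : ℝ) = E + w ∧ c ≤ β * E ∧ B.FinelySpaced h E F := by
  -- The levels divide the interval from `c / β` to `c / β + w` into `n` equal steps, each at most
  -- `h` long.
  obtain ⟨n, hn⟩ := exists_nat_gt (|w| / h)
  have hn0 : (0 : ℝ) < n := lt_of_le_of_lt (div_nonneg (abs_nonneg w) hh.le) hn
  have hwn : |w| ≤ h * n := by
    rw [div_lt_iff₀ hh] at hn
    linarith
  let lev : ℕ → ℝ := fun k => c / β + k / n * w
  let B : Battery := ⟨(Finset.range (n + 1)).image lev, 0⟩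
  have hmem : ∀ k, k ≤ n → lev k ∈ B.levels := fun k hk =>
    Finset.mem_image_of_mem _ (Finset.mem_range.mpr (Nat.lt_succ_of_le hk))
  have hE : lev 0 = c / β := by simp [lev]
  have hF : lev n = c / β + w := by simp [lev, div_self hn0.ne']
  refine ⟨B, ⟨lev 0, hmem 0 (Nat.zero_le n)⟩, ⟨lev n, hmem n le_rfl⟩, ?_, ?_, ?_⟩
  · simp only [hE, hF]
  · simp only [hE]
    rw [mul_div_cancel₀ _ hβ.ne']
  · intro x hx
    simp only [hE, hF] at hx
    rw [← segment_eq_uIcc, segment_eq_image'] at hx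
    obtain ⟨θ, ⟨hθ0, hθ1⟩, rfl⟩ := hx
    have hθn : 0 ≤ θ * n := mul_nonneg hθ0 hn0.le
    have hk1 := Nat.floor_le hθn
    have hk2 := Nat.lt_floor_add_one (θ * n)
    refine ⟨lev ⌊θ * n⌋₊, hmem _ ?_, ?_⟩
    · exact Nat.floor_le_of_le (mul_le_of_le_one_left hn0.le hθ1)
    · have h1 : c / β + θ • (c / β + w - c / β) - lev ⌊θ * n⌋₊ =
          (θ * n - ⌊θ * n⌋₊) * w / n := by
        simp only [lev, smul_eq_mul]
        field_simp
        ring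
      simp only [h1]
      rw [abs_div, abs_mul, abs_of_pos hn0, div_le_iff₀ hn0,
        abs_of_nonneg (sub_nonneg.mpr hk1)]
      refine le_trans (mul_le_of_le_one_left (abs_nonneg w) (by linarith)) hwn

/-- An optimal test exists and has positive `r`-probability as `ε < 1`; full support of `g` then
gives it positive `g`-probability. Logarithms of the error are thus genuine. -/
theorem typeIIError_pos {W : Matrix ι ι ℂ} (hW : IsUnitaryMat W) {r g : ι → ℝ}
    (hr0 : ∀ i, 0 ≤ r i) (hr : ∑ i, r i = 1) (hg : ∀ i, 0 < g i) {ε : ℝ} (hε : 0 ≤ ε) (hε1 : ε < 1) :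
    0 < typeIIError ε (inFrame W r) (inFrame W g) := by
  obtain ⟨q, hq, hqr, hqg⟩ :=
    (typeIIError_le_iff hW hr (fun i => (hg i).le) hε _).mp le_rfl
  refine lt_of_lt_of_le ?_ hqg
  have hpos : 0 < ∑ i, q i * r i := by linarith
  obtain ⟨i, -, hi⟩ := Finset.exists_lt_of_sum_lt (s := Finset.univ) (f := fun _ => (0 : ℝ))
    (by simpa using hpos)
  have hqi : 0 < q i := pos_of_mul_pos_left hi (hr0 i)
  exact Finset.sum_pos' (fun j _ => mul_nonneg (hq j).1 (hg j).le)
    ⟨i, Finset.mem_univ i, mul_pos hqi (hg i)⟩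

/-- The criterion sees the battery only through `F - E`, so any one admissible battery decides
membership; this is the independence of the battery. -/
theorem mem_workGainSet_iff [Nonempty ι] {β μ ε h c : ℝ} {R : GPState ι} {W : Matrix ι ι ℂ}
    {r e n : ι → ℝ} (hR : StateFrame R W r e n) (hβ : 0 < β) (hε : 0 ≤ ε) (hh : 0 < h) (w : ℝ) :
    w ∈ workGainSet β μ h c ε R ↔
      typeIIError ε R.ρ (freeState β μ R.toGPSystem).ρ ≤ Real.exp (-(β * w)) := by
  constructor
  · rintro ⟨B, E, F, hEF, -, -, hreach⟩
    rw [reachesApprox_gain_iff hR hε, hEF, add_sub_cancel_left] at hreach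
    exact hreach
  · intro hw
    obtain ⟨B, E, F, hEF, hc, hfine⟩ := exists_admissible_battery hβ hh c w
    refine ⟨B, E, F, hEF, hc, hfine, ?_⟩
    rwa [reachesApprox_gain_iff hR hε, hEF, add_sub_cancel_left]

theorem mem_workCostSet_iff [Nonempty ι] {β μ ε h c : ℝ} {R : GPState ι} {W : Matrix ι ι ℂ}
    {r e n : ι → ℝ} (hR : StateFrame R W r e n) (hβ : 0 < β) (hh : 0 < h) (w : ℝ) :
    w ∈ workCostSet β μ h c ε R ↔ ∀ A : Finset ι, ∑ i ∈ A, r i - ε ≤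
        Real.exp (β * w) * ∑ i ∈ A, gibbs β μ e n i := by
  constructor
  · rintro ⟨B, E, F, hEF, -, -, hreach⟩
    rw [reachesApprox_cost_iff hR, hEF, add_sub_cancel_left] at hreach
    exact hreach
  · intro hw
    obtain ⟨B, E, F, hEF, hc, hfine⟩ := exists_admissible_battery hβ hh c w
    refine ⟨B, E, F, hEF, hc, hfine, ?_⟩
    rwa [reachesApprox_cost_iff hR, hEF, add_sub_cancel_left]

omit [DecidableEq ι] in
/-- The largest ratio of `ε`-reduced probability and equilibrium probability of an event. -/
theorem exists_max_ratio [Nonempty ι] {r g : ι → ℝ} (hr : ∑ i, r i = 1) (hg : ∀ i, 0 < g i)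
    {ε : ℝ} (hε0 : 0 ≤ ε) (hε1 : ε < 1) :
    ∃ (M : ℝ) (A : Finset ι), 0 < M ∧ 0 < ∑ i ∈ A, g i ∧ ∑ i ∈ A, r i - ε = M * ∑ i ∈ A, g i ∧
      ∀ B : Finset ι, ∑ i ∈ B, r i - ε ≤ M * ∑ i ∈ B, g i := by
  classical
  have hpos : ∀ B : Finset ι, B.Nonempty → 0 < ∑ i ∈ B, g i := fun B hB =>
    Finset.sum_pos (fun i _ => hg i) hB
  obtain ⟨A, hA, hmax⟩ := Finset.exists_max_image
    ((Finset.univ : Finset (Finset ι)).filter fun B => B.Nonempty)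
    (fun B => (∑ i ∈ B, r i - ε) / ∑ i ∈ B, g i) ⟨Finset.univ, by simp⟩
  have hA0 := hpos A (Finset.mem_filter.mp hA).2
  refine ⟨(∑ i ∈ A, r i - ε) / ∑ i ∈ A, g i, A, ?_, hA0, (div_mul_cancel₀ _ hA0.ne').symm, ?_⟩
  · refine lt_of_lt_of_le ?_ (hmax Finset.univ (by simp))
    rw [hr]
    exact div_pos (by linarith) (hpos _ Finset.univ_nonempty)
  · intro B
    rcases B.eq_empty_or_nonempty with rfl | hB
    · simpa using hε0
    · exact (div_le_iff₀ (hpos B hB)).mp (hmax B (by simpa using hB))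

end WorkValue

/-! ### Optimal values and the bounds on the work cost. -/

section WorkBounds

variable {ι : Type} [Fintype ι] [DecidableEq ι]

theorem le_neg_log_div_iff {β t w : ℝ} (hβ : 0 < β) (ht : 0 < t) :
    t ≤ Real.exp (-(β * w)) ↔ w ≤ 1 / β * -Real.log t := by
  rw [← Real.log_le_iff_le_exp ht, one_div_mul_eq_div, le_div_iff₀ hβ]
  constructor <;> intro h <;> linarith

theorem log_div_le_iff {β M w : ℝ} (hβ : 0 < β) (hM : 0 < M) :
    M ≤ Real.exp (β * w) ↔ 1 / β * Real.log M ≤ w := by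
  rw [← Real.log_le_iff_le_exp hM, one_div_mul_eq_div, div_le_iff₀ hβ, mul_comm]

/-- The maximal work gain. -/
theorem isGreatest_workGainSet [Nonempty ι] {β μ ε h c : ℝ} {R : GPState ι} {W : Matrix ι ι ℂ}
    {r e n : ι → ℝ} (hR : StateFrame R W r e n) (hβ : 0 < β) (hε0 : 0 ≤ ε) (hε1 : ε < 1)
    (hh : 0 < h) :
    IsGreatest (workGainSet β μ h c ε R)
      (1 / β * hypTestRelEntropy ε R.ρ (freeState β μ R.toGPSystem).ρ) := by
  have ht : 0 < typeIIError ε R.ρ (freeState β μ R.toGPSystem).ρ := by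
    rw [freeState_eq_inFrame β μ hR.toSysFrame, hR.ρ_eq]
    exact typeIIError_pos hR.unitary hR.nonneg hR.sum_eq_one (gibbs_pos β μ e n) hε0 hε1
  constructor
  · rw [mem_workGainSet_iff hR hβ hε0 hh, le_neg_log_div_iff hβ ht]
    exact le_rfl
  · intro w hw
    rwa [mem_workGainSet_iff hR hβ hε0 hh, le_neg_log_div_iff hβ ht] at hw

/-- Weak duality: the optimal type II error is bounded below by the likelihood-ratio bound. -/
theorem le_mul_typeIIError {W : Matrix ι ι ℂ} (hW : IsUnitaryMat W) {r g : ι → ℝ}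
    (hr : ∑ i, r i = 1) (hg : ∀ i, 0 ≤ g i) {ε δ M : ℝ} (hδ : δ ≤ 1 - ε) (hM0 : 0 ≤ M)
    (hM : ∀ A : Finset ι, ∑ i ∈ A, r i - ε ≤ M * ∑ i ∈ A, g i) :
    δ ≤ M * typeIIError (1 - ε - δ) (inFrame W r) (inFrame W g) := by
  obtain ⟨q, hq, hqr, hqg⟩ :=
    (typeIIError_le_iff hW hr hg (sub_nonneg.mpr hδ) _).mp le_rfl
  -- For the optimal test `q`, the value `q·r - M q·g` is at most that of the event `r > M g`, hence
  -- at most `ε`, while `q·r ≥ ε + δ`.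
  have h1 := sum_mul_le_sum_filter_pos (x := fun i => r i - M * g i) hq
  have h2 := hM (Finset.univ.filter fun i => 0 < r i - M * g i)
  have h3 : ∑ i, q i * (r i - M * g i) = ∑ i, q i * r i - M * ∑ i, q i * g i := by
    rw [Finset.mul_sum, ← Finset.sum_sub_distrib]
    exact Finset.sum_congr rfl fun i _ => by ring
  rw [h3, Finset.sum_sub_distrib, ← Finset.mul_sum] at h1
  have h4 := mul_le_mul_of_nonneg_left hqg hM0
  linarith

/-- A rescaled indicator test bounds the optimal type II error from above. -/
theorem typeIIError_le_of_event {W : Matrix ι ι ℂ} (hW : IsUnitaryMat W) {r g : ι → ℝ}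
    (hr : ∑ i, r i = 1) (hg : ∀ i, 0 ≤ g i) {ε a : ℝ} (hε : 0 ≤ ε) (ha : a ∈ Set.Icc (0 : ℝ) 1)
    (A : Finset ι) (hA : 1 - ε ≤ a * ∑ i ∈ A, r i) :
    typeIIError ε (inFrame W r) (inFrame W g) ≤ a * ∑ i ∈ A, g i := by
  refine (typeIIError_le_iff hW hr hg hε _).mpr
    ⟨fun i => if i ∈ A then a else 0, fun i => ?_, ?_, ?_⟩
  · by_cases hi : i ∈ A
    · simpa [hi] using ha
    · simp [hi]
  · simpa [ite_mul, Finset.sum_ite_mem, Finset.mul_sum] using hA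
  · simp [ite_mul, Finset.sum_ite_mem, Finset.mul_sum]

/-- The minimal work cost and its bounds. -/
theorem workCost_bounds [Nonempty ι] {β μ ε h c : ℝ} {R : GPState ι} {W : Matrix ι ι ℂ}
    {r e n : ι → ℝ} (hR : StateFrame R W r e n) (hβ : 0 < β) (hε0 : 0 ≤ ε) (hε1 : ε < 1)
    (hh : 0 < h) :
    ∃ w : ℝ, IsLeast (workCostSet β μ h c ε R) w ∧
      IsGreatest ((fun δ : ℝ =>
          1 / β * hypTestRelEntropy (1 - ε - δ) R.ρ (freeState β μ R.toGPSystem).ρ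
            - 1 / β * Real.log (1 / δ)) '' Set.Ioc 0 (1 - ε)) w ∧
      (0 < ε → w ≤ 1 / β * hypTestRelEntropy (1 - ε) R.ρ (freeState β μ R.toGPSystem).ρ
          - 1 / β * Real.log ((1 - ε) / ε)) := by
  have hg := gibbs_pos β μ e n
  have hr0 := hR.nonneg
  have hr1 := hR.sum_eq_one
  rw [freeState_eq_inFrame β μ hR.toSysFrame, hR.ρ_eq]
  obtain ⟨M, A, hM0, hgA, hMA, hM⟩ := exists_max_ratio hr1 hg hε0 hε1
  have hrA1 : ∑ i ∈ A, r i ≤ 1 :=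
    hr1 ▸ Finset.sum_le_sum_of_subset_of_nonneg (Finset.subset_univ A) fun i _ _ => hr0 i
  have hrAε : 0 < ∑ i ∈ A, r i - ε := hMA ▸ mul_pos hM0 hgA
  have hval : ∀ δ : ℝ, 0 < δ → ∀ t : ℝ, 0 < t →
      1 / β * -Real.log t - 1 / β * Real.log (1 / δ) = 1 / β * Real.log (δ / t) := by
    intro δ hδ t ht
    rw [Real.log_div hδ.ne' ht.ne', one_div δ, Real.log_inv]
    ring
  have hlog : ∀ x : ℝ, 0 < x → x ≤ M → 1 / β * Real.log x ≤ 1 / β * Real.log M := fun x hx hxM =>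
    mul_le_mul_of_nonneg_left (Real.log_le_log hx hxM) (one_div_pos.mpr hβ).le
  refine ⟨1 / β * Real.log M, ⟨?_, ?_⟩, ⟨?_, ?_⟩, ?_⟩
  · rw [mem_workCostSet_iff hR hβ hh]
    intro B
    refine (hM B).trans (mul_le_mul_of_nonneg_right ?_ (Finset.sum_nonneg fun i _ => (hg i).le))
    exact (log_div_le_iff hβ hM0).mpr le_rfl
  · intro w hw
    rw [mem_workCostSet_iff hR hβ hh] at hw
    rw [← log_div_le_iff hβ hM0]
    have := hw A
    rw [hMA] at this
    exact le_of_mul_le_mul_right this hgA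
  -- For this `δ` the required probability `ε + δ` equals `r(A)`, so the indicator of the maximizing
  -- event is an admissible test and duality is tight.
  · set δ := ∑ i ∈ A, r i - ε with hδ
    have hδ1 : δ ≤ 1 - ε := by linarith
    refine ⟨δ, ⟨hrAε, hδ1⟩, ?_⟩
    have ht := typeIIError_pos hR.unitary hr0 hr1 hg (sub_nonneg.mpr hδ1)
      (by linarith : 1 - ε - δ < 1)
    have h1 := le_mul_typeIIError hR.unitary hr1 (fun i => (hg i).le) hδ1 hM0.le hM
    have h2 := typeIIError_le_of_event hR.unitary hr1 (fun i => (hg i).le)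
      (sub_nonneg.mpr hδ1) (a := 1) (by simp) A (by rw [hδ]; linarith)
    rw [one_mul] at h2
    have h3 : δ / typeIIError (1 - ε - δ) (inFrame W r) (inFrame W (gibbs β μ e n)) = M := by
      rw [div_eq_iff ht.ne']
      refine le_antisymm h1 ?_
      exact (mul_le_mul_of_nonneg_left h2 hM0.le).trans hMA.ge
    simp only [hypTestRelEntropy]
    rw [hval δ hrAε _ ht, h3]
  · rintro _ ⟨δ, ⟨hδ0, hδ1⟩, rfl⟩
    have ht := typeIIError_pos hR.unitary hr0 hr1 hg (sub_nonneg.mpr hδ1)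
      (by linarith : 1 - ε - δ < 1)
    have h1 := le_mul_typeIIError hR.unitary hr1 (fun i => (hg i).le) hδ1 hM0.le hM
    simp only [hypTestRelEntropy]
    rw [hval δ hδ0 _ ht]
    exact hlog _ (div_pos hδ0 ht) ((div_le_iff₀ ht).mpr h1)
  · intro hε
    have hrA : 0 < ∑ i ∈ A, r i := by linarith
    have ht := typeIIError_pos hR.unitary hr0 hr1 hg (by linarith : 0 ≤ 1 - ε)
      (by linarith : 1 - ε < 1)
    -- The factor `ε / r(A)` gives the rescaled indicator `r`-probability exactly `ε`, the least
    -- that level `1 - ε` allows.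
    have h1 := typeIIError_le_of_event hR.unitary hr1 (fun i => (hg i).le)
      (by linarith : 0 ≤ 1 - ε) (a := ε / ∑ i ∈ A, r i)
      ⟨div_nonneg hε0 hrA.le, (div_le_one hrA).mpr (by linarith)⟩ A
      (by rw [div_mul_cancel₀ _ hrA.ne']; linarith)
    set t := typeIIError (1 - ε) (inFrame W r) (inFrame W (gibbs β μ e n))
    have h2 : M * t * (∑ i ∈ A, r i) ≤ ε * (∑ i ∈ A, r i - ε) := by
      rw [div_mul_eq_mul_div, le_div_iff₀ hrA] at h1
      rw [hMA]
      calc M * t * ∑ i ∈ A, r i = M * (t * ∑ i ∈ A, r i) := by ring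
        _ ≤ M * (ε * ∑ i ∈ A, gibbs β μ e n i) := mul_le_mul_of_nonneg_left h1 hM0.le
        _ = _ := by ring
    have h3 : M ≤ ε / (1 - ε) / t := by
      rw [le_div_iff₀ ht, le_div_iff₀ (by linarith)]
      have h4 : (∑ i ∈ A, r i - ε) * (1 - ε) ≤ ∑ i ∈ A, r i := by nlinarith
      refine le_of_mul_le_mul_right ?_ hrA
      calc M * t * (1 - ε) * ∑ i ∈ A, r i = M * t * (∑ i ∈ A, r i) * (1 - ε) := by ring
        _ ≤ ε * (∑ i ∈ A, r i - ε) * (1 - ε) :=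
          mul_le_mul_of_nonneg_right h2 (by linarith)
        _ = ε * ((∑ i ∈ A, r i - ε) * (1 - ε)) := by ring
        _ ≤ ε * ∑ i ∈ A, r i := mul_le_mul_of_nonneg_left h4 hε0
    have h5 := hval (ε / (1 - ε)) (div_pos hε (by linarith)) t ht
    rw [one_div_div] at h5
    simp only [hypTestRelEntropy]
    change _ ≤ 1 / β * -Real.log t - _
    rw [h5]
    exact mul_le_mul_of_nonneg_left (Real.log_le_log hM0 h3) (one_div_pos.mpr hβ).le

end WorkBounds

end GrandPotential

end

/-! ### The main theorem. -/

theorem theorem5 {ι : Type} [Fintype ι] [DecidableEq ι] [Nonempty ι]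
    (β μ : ℝ) (hβ : 0 < β) (R : GrandPotential.GPState ι)
    (ε : ℝ) (hε0 : 0 ≤ ε) (hε1 : ε < 1) (h c : ℝ) (hh : 0 < h) :
    -- the work value
    (IsGreatest (GrandPotential.workGainSet β μ h c ε R)
        (1 / β * GrandPotential.hypTestRelEntropy ε R.ρ
          (GrandPotential.freeState β μ R.toGPSystem).ρ) ∧
      -- it does not depend on the battery
      ∀ (B : GrandPotential.Battery) (E F : B.levels),
        GrandPotential.ReachesApprox β μ ε (R.add (B.state E)) (B.state F) ↔
          (F : ℝ) - E ∈ GrandPotential.workGainSet β μ h c ε R) ∧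
    -- the work cost
    (∃ Wcost : ℝ, IsLeast (GrandPotential.workCostSet β μ h c ε R) Wcost ∧
      (∃ L : ℝ,
        IsGreatest ((fun δ : ℝ =>
          1 / β * GrandPotential.hypTestRelEntropy (1 - ε - δ) R.ρ
              (GrandPotential.freeState β μ R.toGPSystem).ρ
            - 1 / β * Real.log (1 / δ)) '' Set.Ioc 0 (1 - ε)) L ∧
        L ≤ Wcost) ∧
      (0 < ε →
        Wcost ≤ 1 / β * GrandPotential.hypTestRelEntropy (1 - ε) R.ρ
            (GrandPotential.freeState β μ R.toGPSystem).ρ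
          - 1 / β * Real.log ((1 - ε) / ε)) ∧
      -- it does not depend on the battery
      ∀ (B : GrandPotential.Battery) (E F : B.levels),
        GrandPotential.ReachesApprox β μ ε (B.state F) (R.add (B.state E)) ↔
          (F : ℝ) - E ∈ GrandPotential.workCostSet β μ h c ε R) := by
  obtain ⟨W, r, e, n, hR⟩ := R.exists_frame
  obtain ⟨w, hleast, hgreatest, hupper⟩ :=
    GrandPotential.workCost_bounds (μ := μ) (c := c) hR hβ hε0 hε1 hh
  -- The maximum over `δ` and the minimal cost are the same number `w`, whence `le_rfl` for the
  -- lower bound.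
  refine ⟨⟨GrandPotential.isGreatest_workGainSet hR hβ hε0 hε1 hh, fun B E F => ?_⟩,
    w, hleast, ⟨w, hgreatest, le_rfl⟩, hupper, fun B E F => ?_⟩
  · rw [GrandPotential.mem_workGainSet_iff hR hβ hε0 hh,
      GrandPotential.reachesApprox_gain_iff hR hε0]
  · rw [GrandPotential.mem_workCostSet_iff hR hβ hh, GrandPotential.reachesApprox_cost_iff hR]
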